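/- Let $N$ be a lattice of finite rank with dual lattice $M=\operatorname{Hom}(N,\mathbb Z)$, and let $P\subset N_{\mathbb R}$ be a reflexive polytope: a lattice polytope in $N$ with $0$ in its interior whose dual $P^\vee=\{w\in M_{\mathbb R}\mid \langle v,w\rangle\ge -1\ \forall v\in P\}$ is a lattice polytope in $M$. For a reflexive polytope $R$ (in a given lattice), $X_R$ denotes the toric variety over $\mathbb C$ of the spanning fan of $R$, i.e. the fan of cones over the proper faces of $R$. Let $\overline M\subset M$ be the sublattice spanned by the vertices of $P^\vee$, and let $Q$ be the primitive dual of $P$, i.e. the polytope $P^\vee$ regarded as a lattice polytope in $\overline M$. Two toric varieties are called a Batyrev--Borisov mirror pair if they are isomorphic over $\mathbb C$ to $X_R$ and $X_{R^\vee}$ for some reflexive polytope $R$, where $R^\vee$ is taken in the lattice dual to that of $R$. Let $M_1$ be a lattice with $\overline M\subset M_1\subset M$, and let $N_1=M_1^\vee\supset N$ be its dual lattice. The finite group $N_1/N$ acts on $X_P$ through the torus of $X_P$: the class of $v\in N_1$ acts by $\chi^m\mapsto e^{2\pi i\langle v,m\rangle}\chi^m$ $(m\in M)$. In the same way $M_1/\overline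 M$ acts on $X_Q$ through the torus of $X_Q$. Then the geometric quotients $$X_P/(N_1/N)\qquad\text{and}\qquad X_Q/(M_1/\overline M)$$ exist and form a Batyrev--Borisov mirror pair. -/

import Mathlib

open CategoryTheory CategoryTheory.Limits AlgebraicGeometry

noncomputable section

set_option linter.unusedSectionVars false

namespace ToricMirror

/-! ### Lattices and polytopes -/

section Convex

variable {V W : Type} [NormedAddCommGroup V] [NormedSpace ℝ V] [FiniteDimensional ℝ V]
  [NormedAddCommGroup W] [NormedSpace ℝ W] [FiniteDimensional ℝ W]

/-- `N` is a (full rank) lattice in the real vector space `V`, so that `V = N ⊗ ℝ`. -/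
def IsLattice (N : Submodule ℤ V) : Prop :=
  ∃ _ : DiscreteTopology N, IsZLattice ℝ N

/-- The dual lattice `{w ∈ W | ⟨v, w⟩ ∈ ℤ for all v ∈ N}` with respect to a pairing. -/
def dualLattice (p : V →ₗ[ℝ] W →ₗ[ℝ] ℝ) (N : Submodule ℤ V) : Submodule ℤ W where
  carrier := {w | ∀ v ∈ N, ∃ k : ℤ, p v w = k}
  add_mem' := by
    intro a b ha hb v hv
    obtain ⟨k, hk⟩ := ha v hv
    obtain ⟨l, hl⟩ := hb v hv
    exact ⟨k + l, by simp [hk, hl]⟩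
  zero_mem' := fun v _ => ⟨0, by simp⟩
  smul_mem' := by
    intro c a ha v hv
    obtain ⟨k, hk⟩ := ha v hv
    exact ⟨c * k, by rw [map_zsmul, hk]; simp⟩

/-- `P` is a lattice polytope in the lattice `N`. -/
structure IsLatticePolytope (N : Submodule ℤ V) (P : Set V) : Prop where
  isLattice : IsLattice N
  eq_convexHull : ∃ s : Finset V, (∀ v ∈ s, v ∈ N) ∧ P = convexHull ℝ (s : Set V)

/-- The dual `P^∨ = {w | ⟨v, w⟩ ≥ -1 for all v ∈ P}`. -/
def polarDual (p : V →ₗ[ℝ] W →ₗ[ℝ] ℝ) (P : Set V) : Set W :=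
  {w | ∀ v ∈ P, -1 ≤ p v w}

/-- `P` is a reflexive polytope in the lattice `N`: a lattice polytope with the origin in its
interior whose dual is a lattice polytope in the dual lattice. -/
structure IsReflexive (p : V →ₗ[ℝ] W →ₗ[ℝ] ℝ) (N : Submodule ℤ V) (P : Set V) : Prop where
  isLatticePolytope : IsLatticePolytope N P
  zero_mem_interior : (0 : V) ∈ interior P
  dual_isLatticePolytope : IsLatticePolytope (dualLattice p N) (polarDual p P)

theorem zero_mem_interior_polarDual (p : V →ₗ[ℝ] W →ₗ[ℝ] ℝ) {N : Submodule ℤ V} {P : Set V}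
    (hP : IsLatticePolytope N P) : (0 : W) ∈ interior (polarDual p P) := by
  obtain ⟨s, -, rfl⟩ := hP.eq_convexHull
  rw [mem_interior]
  refine ⟨⋂ v ∈ s, {w | -1 < p v w}, ?_, ?_, by simp⟩
  · intro w hw v hv
    simp only [Set.mem_iInter] at hw
    have hc : Convex ℝ {v : V | -1 ≤ p v w} :=
      convex_halfSpace_ge (f := fun v => p v w) (p.flip w).isLinear (-1)
    have hsub : (s : Set V) ⊆ {v : V | -1 ≤ p v w} := fun x hx => by
      have h : -1 < p x w := hw x hx
      exact h.le
    exact convexHull_min hsub hc hv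
  · refine isOpen_biInter_finset fun v _ => ?_
    exact isOpen_lt continuous_const (p v).continuous_of_finiteDimensional

/-- The sublattice of the ambient lattice spanned by the vertices of a polytope. -/
def vertexLattice (P : Set V) : Submodule ℤ V :=
  Submodule.span ℤ (P.extremePoints ℝ)

theorem extremePoints_finite {s : Finset V} :
    ((convexHull ℝ (s : Set V)).extremePoints ℝ).Finite :=
  s.finite_toSet.subset extremePoints_convexHull_subset

theorem convexHull_extremePoints {s : Finset V} :
    convexHull ℝ ((convexHull ℝ (s : Set V)).extremePoints ℝ) = convexHull ℝ (s : Set V) := by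
  have h := closure_convexHull_extremePoints (s.finite_toSet.isCompact_convexHull ℝ)
    (convex_convexHull ℝ (s : Set V))
  rwa [(extremePoints_finite.isCompact_convexHull ℝ).isClosed.closure_eq] at h

/-- A lattice polytope with non-empty interior is a lattice polytope in the lattice
spanned by its own vertices. -/
theorem IsLatticePolytope.vertexLattice {N : Submodule ℤ V} {P : Set V}
    (hP : IsLatticePolytope N P) (h0 : (0 : V) ∈ interior P) :
    IsLatticePolytope (vertexLattice P) P := by
  obtain ⟨⟨hd, hz⟩, s, hs, rfl⟩ := hP
  have hle : ToricMirror.vertexLattice (convexHull ℝ (s : Set V)) ≤ N :=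
    Submodule.span_le.2 fun v hv => hs v (extremePoints_convexHull_subset hv)
  refine ⟨⟨?_, ?_⟩, (extremePoints_finite (s := s)).toFinset, ?_, ?_⟩
  · exact DiscreteTopology.of_subset hd hle
  · let _ : DiscreteTopology (ToricMirror.vertexLattice (convexHull ℝ (s : Set V))) :=
      DiscreteTopology.of_subset hd hle
    constructor
    rw [eq_top_iff]
    set U := Submodule.span ℝ
      ((ToricMirror.vertexLattice (convexHull ℝ (s : Set V)) : Submodule ℤ V) : Set V) with hU
    have h1 : convexHull ℝ (s : Set V) ⊆ U := by
      rw [← convexHull_extremePoints]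
      exact convexHull_min (fun x hx => Submodule.subset_span (Submodule.subset_span hx)) U.convex
    rw [← Submodule.eq_top_of_nonempty_interior' U ⟨0, interior_mono h1 h0⟩]
  · intro v hv
    exact Submodule.subset_span (by simpa using hv)
  · simp [convexHull_extremePoints]

end Convex

/-! ### Fans -/

section Fan

variable {V : Type} [NormedAddCommGroup V] [NormedSpace ℝ V] [FiniteDimensional ℝ V]

/-- `τ` is a face of the cone `σ`: it is cut out of `σ` by a linear functional which is
non-negative on `σ`. -/
def IsConeFace (τ σ : PointedCone ℝ V) : Prop :=
  ∃ f : Module.Dual ℝ V, (∀ x ∈ σ, 0 ≤ f x) ∧ ∀ x, x ∈ τ ↔ x ∈ σ ∧ f x = 0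

/-- A fan in the lattice `N`: a finite collection of strongly convex rational polyhedral cones,
closed under passing to faces, any two of which meet along a common face. -/
structure Fan (N : Submodule ℤ V) where
  isLattice : IsLattice N
  cones : Set (PointedCone ℝ V)
  finite : cones.Finite
  rational : ∀ σ ∈ cones, ∃ s : Finset V, (∀ v ∈ s, v ∈ N) ∧ σ = PointedCone.hull ℝ (s : Set V)
  stronglyConvex : ∀ σ ∈ cones, ∀ x, x ∈ σ → -x ∈ σ → x = 0
  face_mem : ∀ σ ∈ cones, ∀ τ, IsConeFace τ σ → τ ∈ cones
  inf_face : ∀ σ ∈ cones, ∀ τ ∈ cones, IsConeFace (σ ⊓ τ) σ ∧ IsConeFace (σ ⊓ τ) τ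

theorem dual_nonneg_of_mem_hull {T : Set V} {f : Module.Dual ℝ V} (hf : ∀ v ∈ T, 0 ≤ f v)
    {x : V} (hx : x ∈ PointedCone.hull ℝ T) : 0 ≤ f x := by
  induction hx using Submodule.span_induction with
  | mem x h => exact hf x h
  | zero => simp
  | add x y _ _ hx hy => rw [map_add]; exact add_nonneg hx hy
  | smul c x _ hx =>
    have : f (c • x) = (c : ℝ) * f x := by
      rw [show c • x = (c : ℝ) • x from rfl, map_smul, smul_eq_mul]
    rw [this]
    exact mul_nonneg c.2 hx

theorem mem_hull_filter_iff {T : Finset V} {f : Module.Dual ℝ V} (hf : ∀ v ∈ T, 0 ≤ f v)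
    {x : V} : x ∈ PointedCone.hull ℝ {v | v ∈ T ∧ f v = 0} ↔
      x ∈ PointedCone.hull ℝ (T : Set V) ∧ f x = 0 := by
  constructor
  · intro hx
    refine ⟨Submodule.span_mono (fun v hv => hv.1) hx, le_antisymm ?_ ?_⟩
    · have := dual_nonneg_of_mem_hull (f := -f) (T := {v | v ∈ T ∧ f v = 0})
        (fun v hv => by simp [hv.2]) hx
      simpa using this
    · exact dual_nonneg_of_mem_hull (fun v hv => hv.2.ge) hx
  · rintro ⟨hx, hfx⟩
    obtain ⟨c, -, rfl⟩ := Submodule.mem_span_finset.1 hx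
    rw [map_sum] at hfx
    have hsm : ∀ v, f (c v • v) = (c v : ℝ) * f v := fun v => by
      rw [show c v • v = (c v : ℝ) • v from rfl, map_smul, smul_eq_mul]
    have h0 := (Finset.sum_eq_zero_iff_of_nonneg
      (fun v hv => by rw [hsm]; exact mul_nonneg (c v).2 (hf v hv))).1 hfx
    refine Submodule.sum_mem _ fun v hv => ?_
    have h1 := h0 v hv
    rw [hsm, mul_eq_zero] at h1
    rcases h1 with h1 | h1
    · have : c v = 0 := Subtype.ext h1
      rw [this, zero_smul]
      exact Submodule.zero_mem _
    · exact Submodule.smul_mem _ _ (Submodule.subset_span ⟨hv, h1⟩)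

/-- The cones over the proper faces of `P`. -/
def spanningCones (P : Set V) : Set (PointedCone ℝ V) :=
  {σ | ∃ F : Set V, IsExposed ℝ P F ∧ F ≠ P ∧ σ = PointedCone.hull ℝ F}

theorem mem_spanningCones_iff {s : Finset V} (h0 : (0 : V) ∈ interior (convexHull ℝ (s : Set V)))
    {σ : PointedCone ℝ V} :
    σ ∈ spanningCones (convexHull ℝ (s : Set V)) ↔ ∃ l : Module.Dual ℝ V,
      (∀ v ∈ s, l v ≤ 1) ∧ σ = PointedCone.hull ℝ {v | v ∈ s ∧ l v = 1} := by
  set P := convexHull ℝ (s : Set V) with hP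
  have hle : ∀ l : Module.Dual ℝ V, (∀ v ∈ s, l v ≤ 1) → ∀ x ∈ P, l x ≤ 1 := fun l hl x hx =>
    convexHull_min (t := {x | l x ≤ 1}) hl (convex_halfSpace_le l.isLinear 1) hx
  have hhull : ∀ l : Module.Dual ℝ V, (∀ v ∈ s, l v ≤ 1) →
      PointedCone.hull ℝ {x | x ∈ P ∧ l x = 1} = PointedCone.hull ℝ {v | v ∈ s ∧ l v = 1} := by
    intro l hl
    apply le_antisymm
    · refine Submodule.span_le.2 ?_
      rintro x ⟨hx, hlx⟩
      rw [hP, Finset.mem_convexHull'] at hx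
      obtain ⟨w, hw0, hw1, rfl⟩ := hx
      have h1 : ∑ v ∈ s, w v * (1 - l v) = 0 := by
        simp only [mul_sub, mul_one, Finset.sum_sub_distrib, hw1]
        rw [map_sum] at hlx
        simp only [map_smul, smul_eq_mul] at hlx
        linarith
      have h2 := (Finset.sum_eq_zero_iff_of_nonneg
        (fun v hv => mul_nonneg (hw0 v hv) (sub_nonneg.2 (hl v hv)))).1 h1
      refine Submodule.sum_mem _ fun v hv => ?_
      rcases mul_eq_zero.1 (h2 v hv) with h | h
      · rw [h, zero_smul]
        exact Submodule.zero_mem _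
      · exact PointedCone.smul_mem _ (hw0 v hv) (Submodule.subset_span ⟨hv, by linarith⟩)
    · exact Submodule.span_mono fun v hv => ⟨subset_convexHull ℝ _ hv.1, hv.2⟩
  constructor
  · rintro ⟨F, hF, hne, rfl⟩
    rcases F.eq_empty_or_nonempty with rfl | hFn
    · exact ⟨0, by simp, by simp⟩
    · obtain ⟨l, rfl⟩ := hF hFn
      obtain ⟨x₀, hx₀, hmax⟩ := hFn
      have hc0 : 0 ≤ l x₀ := by simpa using hmax 0 (interior_subset h0)
      have hc : 0 < l x₀ := by
        refine lt_of_le_of_ne hc0 fun h => hne ?_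
        refine Set.Subset.antisymm (fun x hx => hx.1) fun y hy => ⟨hy, fun z hz => ?_⟩
        have hlim : Filter.Tendsto (fun t : ℝ => -(t • y)) (nhdsWithin 0 (Set.Ioi 0))
            (nhds (0 : V)) := by
          have : Continuous fun t : ℝ => -(t • y) := by fun_prop
          have h2 := this.tendsto 0
          simp only [zero_smul, neg_zero] at h2
          exact h2.mono_left nhdsWithin_le_nhds
        have hev := hlim.eventually (mem_interior_iff_mem_nhds.1 h0)
        obtain ⟨t, ht, ht0⟩ := (hev.and self_mem_nhdsWithin).exists
        have h3 := hmax _ ht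
        simp only [map_neg, map_smul, smul_eq_mul, ← h] at h3
        have h4 : 0 ≤ l y := by
          have ht0' : (0 : ℝ) < t := ht0
          by_contra hcon
          nlinarith
        have h5 := hmax z hz
        linarith
      set l' : Module.Dual ℝ V := (l x₀)⁻¹ • (l : V →ₗ[ℝ] ℝ) with hl'
      have hl'a : ∀ x, l' x = (l x₀)⁻¹ * l x := fun x => rfl
      have hl1 : ∀ x ∈ P, l' x ≤ 1 := fun x hx => by
        rw [hl'a, inv_mul_le_iff₀ hc, mul_one]
        exact hmax x hx
      refine ⟨l', fun v hv => hl1 v (subset_convexHull ℝ _ hv), ?_⟩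
      rw [← hhull l' fun v hv => hl1 v (subset_convexHull ℝ _ hv)]
      congr 1
      ext x
      refine and_congr_right fun hx => ?_
      rw [hl'a, inv_mul_eq_iff_eq_mul₀ hc.ne', mul_one]
      exact ⟨fun h => le_antisymm (hmax x hx) (h x₀ hx₀), fun h y hy => h ▸ hmax y hy⟩
  · rintro ⟨l, hl, rfl⟩
    refine ⟨{x | x ∈ P ∧ l x = 1}, ?_, ?_, (hhull l hl).symm⟩
    · rintro ⟨x₀, hx₀, hlx₀⟩
      refine ⟨LinearMap.toContinuousLinearMap l, ?_⟩
      ext x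
      refine and_congr_right fun hx => ?_
      simp only [LinearMap.coe_toContinuousLinearMap']
      exact ⟨fun h y hy => h ▸ hle l hl y hy,
        fun h => le_antisymm (hle l hl x hx) (hlx₀ ▸ h x₀ hx₀)⟩
    · intro h
      have h1 : (0 : V) ∈ P := interior_subset h0
      rw [← h] at h1
      simpa using h1.2

/-- The spanning fan of a lattice polytope with the origin in its interior. -/
def spanningFan {N : Submodule ℤ V} {P : Set V} (hP : IsLatticePolytope N P)
    (h0 : (0 : V) ∈ interior P) : Fan N where
  isLattice := hP.isLattice
  cones := spanningCones P
  finite := by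
    obtain ⟨s, hs, rfl⟩ := hP.eq_convexHull
    refine ((s.finite_toSet.powerset).image fun T => PointedCone.hull ℝ T).subset ?_
    intro σ hσ
    obtain ⟨l, hl, rfl⟩ := (mem_spanningCones_iff h0).1 hσ
    exact ⟨_, fun v hv => hv.1, rfl⟩
  rational := by
    classical
    obtain ⟨s, hs, rfl⟩ := hP.eq_convexHull
    intro σ hσ
    obtain ⟨l, hl, rfl⟩ := (mem_spanningCones_iff h0).1 hσ
    exact ⟨s.filter fun v => l v = 1, fun v hv => hs v (Finset.mem_filter.1 hv).1, by simp⟩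
  stronglyConvex := by
    classical
    obtain ⟨s, hs, rfl⟩ := hP.eq_convexHull
    intro σ hσ x hx hx'
    obtain ⟨l, hl, rfl⟩ := (mem_spanningCones_iff h0).1 hσ
    have hpos : ∀ v ∈ {v | v ∈ s ∧ l v = 1}, 0 ≤ l v := fun v hv => by rw [hv.2]; norm_num
    have h1 := dual_nonneg_of_mem_hull hpos hx
    have h2 := dual_nonneg_of_mem_hull hpos hx'
    rw [map_neg] at h2
    have h3 := (mem_hull_filter_iff (T := s.filter fun v => l v = 1) (f := l)
      (fun v hv => hpos v (Finset.mem_filter.1 hv)) (x := x)).2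
      ⟨by simpa using hx, by linarith⟩
    have h4 : {v | v ∈ s.filter (fun v => l v = 1) ∧ l v = 0} = (∅ : Set V) := by
      ext v
      simp only [Finset.mem_filter, Set.mem_empty_iff_false, iff_false]
      rintro ⟨⟨-, h⟩, h'⟩
      rw [h] at h'
      exact one_ne_zero h'
    rw [h4] at h3
    simpa using h3
  face_mem := by
    classical
    obtain ⟨s, hs, rfl⟩ := hP.eq_convexHull
    rintro σ hσ τ ⟨f, hf, hτ⟩
    obtain ⟨l, hl, rfl⟩ := (mem_spanningCones_iff h0).1 hσ
    have hf' : ∀ v ∈ s, l v = 1 → 0 ≤ f v := fun v hv h => hf v (Submodule.subset_span ⟨hv, h⟩)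
    have hev : ∀ᶠ t in nhdsWithin (0 : ℝ) (Set.Ioi 0), ∀ v ∈ s, l v < 1 → l v - t * f v < 1 := by
      rw [Filter.eventually_all_finset]
      intro v hv
      by_cases h : l v < 1
      · have hc : Continuous fun t : ℝ => l v - t * f v := by fun_prop
        have h2 := hc.tendsto 0
        simp only [zero_mul, sub_zero] at h2
        filter_upwards [(h2.mono_left nhdsWithin_le_nhds).eventually (Iio_mem_nhds h)] with t ht _
        exact ht
      · exact Filter.Eventually.of_forall fun t h' => absurd h' h
    obtain ⟨t, ht, ht0⟩ := (hev.and self_mem_nhdsWithin).exists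
    have ht0' : (0 : ℝ) < t := ht0
    have hla : ∀ v, (l - t • f) v = l v - t * f v := fun v => by simp
    refine (mem_spanningCones_iff h0).2 ⟨l - t • f, fun v hv => ?_, ?_⟩
    · rw [hla]
      rcases (hl v hv).lt_or_eq with h | h
      · exact (ht v hv h).le
      · rw [h]
        have := mul_nonneg ht0'.le (hf' v hv h)
        linarith
    · have hset : {v | v ∈ s ∧ (l - t • f) v = 1} =
          {v | v ∈ s.filter (fun v => l v = 1) ∧ f v = 0} := by
        ext v
        simp only [Finset.mem_filter, hla, and_assoc]
        refine and_congr_right fun hv => ?_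
        constructor
        · intro h
          rcases (hl v hv).lt_or_eq with h' | h'
          · exact absurd h (ht v hv h').ne
          · refine ⟨h', ?_⟩
            have : t * f v = 0 := by linarith
            exact (mul_eq_zero.1 this).resolve_left ht0'.ne'
        · rintro ⟨h, h'⟩
          rw [h, h']; ring
      rw [hset]
      ext x
      rw [hτ, mem_hull_filter_iff (fun v hv =>
        hf' v (Finset.mem_filter.1 hv).1 (Finset.mem_filter.1 hv).2)]
      simp
  inf_face := by
    classical
    obtain ⟨s, hs, rfl⟩ := hP.eq_convexHull
    have key : ∀ l l' : Module.Dual ℝ V, (∀ v ∈ s, l v ≤ 1) → (∀ v ∈ s, l' v ≤ 1) →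
        IsConeFace (PointedCone.hull ℝ {v | v ∈ s ∧ l v = 1} ⊓
          PointedCone.hull ℝ {v | v ∈ s ∧ l' v = 1}) (PointedCone.hull ℝ {v | v ∈ s ∧ l v = 1}) := by
      intro l l' hl hl'
      have h1 : ∀ v ∈ {v | v ∈ s ∧ l v = 1}, 0 ≤ (l - l') v := fun v hv => by
        have := hl' v hv.1
        simp only [LinearMap.sub_apply, hv.2]; linarith
      have h2 : ∀ v ∈ {v | v ∈ s ∧ l' v = 1}, 0 ≤ (l' - l) v := fun v hv => by
        have := hl v hv.1
        simp only [LinearMap.sub_apply, hv.2]; linarith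
      refine ⟨l - l', fun x hx => dual_nonneg_of_mem_hull h1 hx, fun x => ?_⟩
      rw [Submodule.mem_inf]
      refine and_congr_right fun hx => ⟨fun hx' => ?_, fun h => ?_⟩
      · have h3 := dual_nonneg_of_mem_hull h1 hx
        have h4 := dual_nonneg_of_mem_hull h2 hx'
        simp only [LinearMap.sub_apply] at h3 h4 ⊢
        linarith
      · have h3 := (mem_hull_filter_iff (T := s.filter fun v => l v = 1) (f := l - l')
          (fun v hv => h1 v (Finset.mem_filter.1 hv)) (x := x)).2 ⟨by simpa using hx, h⟩
        refine Submodule.span_mono ?_ h3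
        rintro v ⟨hv, hv'⟩
        obtain ⟨hvs, hlv⟩ := Finset.mem_filter.1 hv
        refine ⟨hvs, ?_⟩
        simp only [LinearMap.sub_apply] at hv'
        linarith
    intro σ hσ τ hτ
    obtain ⟨l, hl, rfl⟩ := (mem_spanningCones_iff h0).1 hσ
    obtain ⟨l', hl', rfl⟩ := (mem_spanningCones_iff h0).1 hτ
    refine ⟨key l l' hl hl', ?_⟩
    rw [inf_comm]
    exact key l' l hl' hl

end Fan

/-! ### Rational functionals -/

section Rational

theorem exists_rat_functional (E : Submodule ℚ ℝ) [FiniteDimensional ℚ E] {T : Set E}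
    (hT : T.Finite) : ∃ φ : E →ₗ[ℚ] ℚ, ∀ t ∈ T, 0 < (t : ℝ) → 0 < φ t := by
  let e := Module.finBasis ℚ E
  have hsum : ∀ t : E, (t : ℝ) = ∑ k, (e.repr t k : ℝ) * (e k : ℝ) := fun t => by
    have h := congrArg (fun u : E => (u : ℝ)) (e.sum_repr t)
    simp only [Submodule.coe_sum, Submodule.coe_smul, Rat.smul_def] at h
    exact h.symm
  let O : Set (Fin (Module.finrank ℚ E) → ℝ) :=
    ⋂ t ∈ {t ∈ T | 0 < (t : ℝ)}, {y | 0 < ∑ k, (e.repr t k : ℝ) * y k}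
  have hO : IsOpen O := by
    refine (hT.subset fun t ht => ht.1).isOpen_biInter fun t _ => ?_
    exact isOpen_lt continuous_const (by fun_prop)
  have hne : O.Nonempty := by
    refine ⟨fun k => (e k : ℝ), ?_⟩
    simp only [O, Set.mem_iInter]
    intro t ht
    change 0 < ∑ k, (e.repr t k : ℝ) * (e k : ℝ)
    rw [← hsum t]
    exact ht.2
  have hd : DenseRange (Pi.map fun (_ : Fin (Module.finrank ℚ E)) (q : ℚ) => (q : ℝ)) :=
    DenseRange.piMap fun _ => Rat.denseRange_cast
  obtain ⟨q, hq⟩ := hd.exists_mem_open hO hne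
  refine ⟨e.constr ℚ q, fun t ht ht0 => ?_⟩
  simp only [O, Set.mem_iInter] at hq
  have h1 : 0 < ∑ k, (e.repr t k : ℝ) * (Pi.map (fun _ (q : ℚ) => (q : ℝ)) q) k := hq t ⟨ht, ht0⟩
  rw [Module.Basis.constr_apply_fintype]
  simp only [Pi.map_apply] at h1
  simp only [Module.Basis.equivFun_apply, smul_eq_mul]
  exact_mod_cast h1

variable {V W : Type} [NormedAddCommGroup V] [NormedSpace ℝ V] [FiniteDimensional ℝ V]
  [NormedAddCommGroup W] [NormedSpace ℝ W] [FiniteDimensional ℝ W]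

/-- A functional which is non-negative on finitely many lattice vectors may be replaced by a
point of the dual lattice with the same zeros among them. -/
theorem exists_mem_dualLattice (p : V →ₗ[ℝ] W →ₗ[ℝ] ℝ) [p.IsPerfPair] {N : Submodule ℤ V}
    (hN : IsLattice N) {s : Finset V} (hs : ∀ v ∈ s, v ∈ N) {f : Module.Dual ℝ V}
    (hf : ∀ v ∈ s, 0 ≤ f v) :
    ∃ m ∈ dualLattice p N, ∀ v ∈ s, 0 ≤ p v m ∧ (p v m = 0 ↔ f v = 0) := by
  classical
  obtain ⟨hd, hz⟩ := hN
  have : Module.Finite ℤ N := ZLattice.module_finite ℝ N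
  have : Module.Free ℤ N := ZLattice.module_free ℝ N
  let bZ := Module.Free.chooseBasis ℤ N
  let b := bZ.ofZLatticeBasis ℝ N
  let x := fun i => f (b i)
  let E := Submodule.span ℚ (Set.range x)
  have : FiniteDimensional ℚ E := FiniteDimensional.span_of_finite ℚ (Set.finite_range x)
  let xE : _ → E := fun i => ⟨x i, Submodule.subset_span ⟨i, rfl⟩⟩
  have hrepr : ∀ (v : V) (hv : v ∈ N) i, b.repr v i = (bZ.repr ⟨v, hv⟩ i : ℝ) := fun v hv i =>
    bZ.ofZLatticeBasis_repr_apply ℝ N ⟨v, hv⟩ i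
  let t : V → E := fun v => if hv : v ∈ N then ∑ i, bZ.repr ⟨v, hv⟩ i • xE i else 0
  have ht : ∀ v ∈ N, (t v : ℝ) = f v := fun v hv => by
    conv_rhs => rw [← b.sum_repr v]
    simp only [t, dif_pos hv, map_sum, map_smul, smul_eq_mul, hrepr v hv]
    simp [xE, x]
  obtain ⟨φ, hφ⟩ := exists_rat_functional E ((s.finite_toSet).image t)
  let D : ℕ := ∏ i, (φ (xE i)).den
  have hD : 0 < D := Finset.prod_pos fun i _ => (φ (xE i)).den_pos
  have hDi : ∀ i, ∃ k : ℤ, (D : ℚ) * φ (xE i) = k := fun i => by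
    obtain ⟨c, hc⟩ := Finset.dvd_prod_of_mem (fun i => (φ (xE i)).den) (Finset.mem_univ i)
    refine ⟨c * (φ (xE i)).num, ?_⟩
    have h1 : (D : ℚ) = (φ (xE i)).den * c := by exact_mod_cast hc
    rw [h1, mul_right_comm, Rat.den_mul_eq_num]
    push_cast
    ring
  let g : Module.Dual ℝ V := b.constr ℝ fun i => ((D * φ (xE i) : ℚ) : ℝ)
  have hg : ∀ v ∈ N, g v = ((D * φ (t v) : ℚ) : ℝ) := fun v hv => by
    simp only [g, Module.Basis.constr_apply_fintype, Module.Basis.equivFun_apply, smul_eq_mul,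
      hrepr v hv, t, dif_pos hv, map_sum, map_zsmul, Finset.mul_sum]
    push_cast
    refine Finset.sum_congr rfl fun i _ => ?_
    simp
    ring
  let m := p.flip.toPerfPair.symm g
  have hm : ∀ v, p v m = g v := fun v => p.apply_toPerfPair_flip g v
  refine ⟨m, fun v hv => ?_, fun v hv => ?_⟩
  · choose k hk using hDi
    refine ⟨∑ i, bZ.repr ⟨v, hv⟩ i * k i, ?_⟩
    rw [hm]
    simp only [g, Module.Basis.constr_apply_fintype, Module.Basis.equivFun_apply, smul_eq_mul,
      hrepr v hv, hk]
    push_cast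
    rfl
  · rw [hm, hg v (hs v hv)]
    have hD' : (0 : ℚ) < D := by exact_mod_cast hD
    rcases (hf v hv).eq_or_lt with h | h
    · have h1 : t v = 0 := Subtype.ext ((ht v (hs v hv)).trans h.symm)
      simp [h1, ← h]
    · have h1 : 0 < φ (t v) := hφ _ ⟨v, hv, rfl⟩ (by rw [ht v (hs v hv)]; exact h)
      have h2 : (0 : ℝ) < ((D * φ (t v) : ℚ) : ℝ) := by exact_mod_cast mul_pos hD' h1
      exact ⟨h2.le, fun h3 => absurd h3 h2.ne', fun h3 => absurd h3 h.ne'⟩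

end Rational

/-! ### Toric varieties over the complex numbers -/

section Toric

variable {V W : Type} [NormedAddCommGroup V] [NormedSpace ℝ V] [FiniteDimensional ℝ V]
  [NormedAddCommGroup W] [NormedSpace ℝ W] [FiniteDimensional ℝ W]
  (p : V →ₗ[ℝ] W →ₗ[ℝ] ℝ) (N : Submodule ℤ V)

/-- The monoid `σ^∨ ∩ M`, where `M` is the lattice dual to `N`. -/
def dualMonoid (σ : PointedCone ℝ V) : AddSubmonoid W where
  carrier := {m | m ∈ dualLattice p N ∧ ∀ v ∈ σ, 0 ≤ p v m}
  add_mem' := by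
    rintro a b ⟨ha, ha'⟩ ⟨hb, hb'⟩
    refine ⟨add_mem ha hb, fun v hv => ?_⟩
    rw [map_add]
    exact add_nonneg (ha' v hv) (hb' v hv)
  zero_mem' := ⟨zero_mem _, by simp⟩

theorem dualMonoid_anti {σ τ : PointedCone ℝ V} (h : τ ≤ σ) :
    dualMonoid p N σ ≤ dualMonoid p N τ :=
  fun _ hm => ⟨hm.1, fun v hv => hm.2 v (h hv)⟩

/-- The coordinate ring `ℂ[σ^∨ ∩ M]`. -/
abbrev ConeRing (σ : PointedCone ℝ V) : Type := AddMonoidAlgebra ℂ (dualMonoid p N σ)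

/-- The inclusion `ℂ[σ^∨ ∩ M] → ℂ[τ^∨ ∩ M]` for `τ ⊆ σ`. -/
def coneRingMap {σ τ : PointedCone ℝ V} (h : τ ≤ σ) : ConeRing p N σ →ₐ[ℂ] ConeRing p N τ :=
  AddMonoidAlgebra.mapDomainAlgHom ℂ ℂ (AddSubmonoid.inclusion (dualMonoid_anti p N h))

theorem coneRingMap_single {σ τ : PointedCone ℝ V} (h : τ ≤ σ) (m : dualMonoid p N σ) (c : ℂ) :
    coneRingMap p N h (AddMonoidAlgebra.single m c) =
      AddMonoidAlgebra.single (AddSubmonoid.inclusion (dualMonoid_anti p N h) m) c := by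
  simp [coneRingMap]

theorem coneRingMap_injective {σ τ : PointedCone ℝ V} (h : τ ≤ σ) :
    Function.Injective (coneRingMap p N h) := by
  have := AddSubmonoid.inclusion_injective (dualMonoid_anti p N h)
  exact AddMonoidAlgebra.mapDomain_injective this

theorem isLocalization_coneRing {σ τ : PointedCone ℝ V} (hτσ : τ ≤ σ) {s : Finset V}
    (hσ : σ = PointedCone.hull ℝ (s : Set V)) (m : dualMonoid p N σ)
    (hm : ∀ x, x ∈ τ ↔ x ∈ σ ∧ p x m = 0) :
    letI := (coneRingMap p N hτσ).toRingHom.toAlgebra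
    IsLocalization.Away (AddMonoidAlgebra.single m (1 : ℂ) : ConeRing p N σ)
      (ConeRing p N τ) := by
  let _ := (coneRingMap p N hτσ).toRingHom.toAlgebra
  have halg : ∀ a : ConeRing p N σ, algebraMap (ConeRing p N σ) (ConeRing p N τ) a =
    coneRingMap p N hτσ a := fun _ => rfl
  have hsσ : ∀ v ∈ s, v ∈ σ := fun v hv => hσ ▸ Submodule.subset_span hv
  have hneg : -(m : W) ∈ dualMonoid p N τ := by
    refine ⟨neg_mem m.2.1, fun v hv => ?_⟩
    rw [map_neg, ((hm v).1 hv).2, neg_zero]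
  have hclear : ∀ u ∈ dualMonoid p N τ, ∃ k : ℕ, u + k • (m : W) ∈ dualMonoid p N σ := by
    intro u hu
    have h1 : ∀ v ∈ s, ∃ k : ℕ, ∀ j ≥ k, 0 ≤ p v (u + j • (m : W)) := by
      intro v hv
      rcases (m.2.2 v (hsσ v hv)).eq_or_lt with h | h
      · refine ⟨0, fun j _ => ?_⟩
        rw [map_add, map_nsmul, ← h, smul_zero, add_zero]
        exact hu.2 v ((hm v).2 ⟨hsσ v hv, h.symm⟩)
      · obtain ⟨k, hk⟩ := exists_nat_ge (-(p v u) / p v m)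
        refine ⟨k, fun j hj => ?_⟩
        rw [map_add, map_nsmul, nsmul_eq_mul]
        rw [div_le_iff₀ h] at hk
        have : (k : ℝ) ≤ j := by exact_mod_cast hj
        nlinarith
    choose! k hk using h1
    refine ⟨s.sup k, add_mem hu.1 (nsmul_mem m.2.1 _), fun v hv => ?_⟩
    rw [hσ] at hv
    exact dual_nonneg_of_mem_hull (f := p.flip (u + s.sup k • (m : W)))
      (fun v hv => hk v hv _ (Finset.le_sup hv)) hv
  refine IsLocalization.Away.mk _ ?_ ?_ ?_
  · rw [halg, coneRingMap_single]
    refine IsUnit.of_mul_eq_one (AddMonoidAlgebra.single ⟨_, hneg⟩ 1) ?_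
    rw [AddMonoidAlgebra.single_mul_single, AddMonoidAlgebra.one_def]
    congr 1
    · ext
      simp
    · simp
  · intro a
    induction a using AddMonoidAlgebra.induction_linear with
    | zero => exact ⟨0, 0, by simp⟩
    | add a b ha hb =>
      obtain ⟨i, x, hx⟩ := ha
      obtain ⟨j, y, hy⟩ := hb
      refine ⟨i + j, x * AddMonoidAlgebra.single m 1 ^ j + y * AddMonoidAlgebra.single m 1 ^ i, ?_⟩
      rw [map_add, map_mul, map_mul, ← hx, ← hy, map_pow, map_pow]
      ring
    | single u c =>
      obtain ⟨k, hk⟩ := hclear u u.2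
      refine ⟨k, AddMonoidAlgebra.single ⟨_, hk⟩ c, ?_⟩
      rw [halg, halg, coneRingMap_single, coneRingMap_single, AddMonoidAlgebra.single_pow,
        AddMonoidAlgebra.single_mul_single]
      congr 1
      simp
  · intro a b hab
    exact ⟨0, by rw [coneRingMap_injective p N hτσ hab]⟩

theorem coneRing_algHom_ext {σ τ : PointedCone ℝ V} {f g : ConeRing p N σ →ₐ[ℂ] ConeRing p N τ}
    (h : ∀ m, f (AddMonoidAlgebra.single m 1) = g (AddMonoidAlgebra.single m 1)) : f = g :=
  AddMonoidAlgebra.algHom_ext h (Subsingleton.elim _ _)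

theorem coneRingMap_refl (σ : PointedCone ℝ V) :
    coneRingMap p N (le_refl σ) = AlgHom.id ℂ _ :=
  coneRing_algHom_ext p N fun m => by rw [coneRingMap_single]; rfl

theorem coneRingMap_comp {ρ τ σ : PointedCone ℝ V} (h : ρ ≤ τ) (h' : τ ≤ σ) :
    (coneRingMap p N h).comp (coneRingMap p N h') = coneRingMap p N (h.trans h') :=
  coneRing_algHom_ext p N fun m => by
    rw [AlgHom.comp_apply, coneRingMap_single, coneRingMap_single, coneRingMap_single]; rfl

variable {N}

/-- The diagram of affine toric varieties `U_σ = Spec ℂ[σ^∨ ∩ M]`, `σ` a cone of the fan. -/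
def Fan.diagram (Φ : Fan N) : Φ.cones ⥤ Scheme.{0} where
  obj σ := Spec (CommRingCat.of (ConeRing p N σ.1))
  map {τ σ} h := Spec.map (CommRingCat.ofHom (coneRingMap p N (leOfHom h)).toRingHom)
  map_id σ := by
    rw [← Spec.map_id, ← CommRingCat.ofHom_id]
    congr 2
    exact congrArg AlgHom.toRingHom (coneRingMap_refl p N σ.1)
  map_comp {ρ τ σ} f g := by
    rw [← Spec.map_comp, ← CommRingCat.ofHom_comp]
    congr 2
    exact congrArg AlgHom.toRingHom (coneRingMap_comp p N (leOfHom f) (leOfHom g)).symm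

variable [p.IsPerfPair]

theorem Fan.exists_monomial (Φ : Fan N) {σ τ : PointedCone ℝ V} (hσ : σ ∈ Φ.cones)
    (hτ : IsConeFace τ σ) :
    ∃ m : dualMonoid p N σ, ∀ x, x ∈ τ ↔ x ∈ σ ∧ p x m = 0 := by
  obtain ⟨s, hs, rfl⟩ := Φ.rational σ hσ
  obtain ⟨f, hf, hτ⟩ := hτ
  have hfs : ∀ v ∈ s, 0 ≤ f v := fun v hv => hf v (Submodule.subset_span hv)
  obtain ⟨m, hm, hm'⟩ := exists_mem_dualLattice p Φ.isLattice hs hfs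
  have hms : ∀ v ∈ s, 0 ≤ p.flip m v := fun v hv => (hm' v hv).1
  refine ⟨⟨m, hm, fun v hv => dual_nonneg_of_mem_hull (f := p.flip m) hms hv⟩, fun x => ?_⟩
  have h1 := mem_hull_filter_iff (f := p.flip m) hms (x := x)
  have hset : {v | v ∈ s ∧ p.flip m v = 0} = {v | v ∈ s ∧ f v = 0} := by
    ext v
    exact and_congr_right fun hv => (hm' v hv).2
  rw [hset, mem_hull_filter_iff hfs] at h1
  rw [hτ]
  exact h1

theorem Fan.isConeFace_of_le (Φ : Fan N) {σ τ : PointedCone ℝ V} (hσ : σ ∈ Φ.cones)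
    (hτ : τ ∈ Φ.cones) (h : τ ≤ σ) : IsConeFace τ σ := by
  have h1 := (Φ.inf_face σ hσ τ hτ).1
  rwa [inf_eq_right.2 h] at h1

instance (Φ : Fan N) {τ σ : Φ.cones} (h : τ ⟶ σ) : IsOpenImmersion ((Φ.diagram p).map h) := by
  obtain ⟨m, hm⟩ := Φ.exists_monomial p σ.2 (Φ.isConeFace_of_le σ.2 τ.2 (leOfHom h))
  obtain ⟨s, -, hs⟩ := Φ.rational σ.1 σ.2
  let _ := (coneRingMap p N (leOfHom h)).toRingHom.toAlgebra
  have := isLocalization_coneRing p N (leOfHom h) hs m hm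
  exact IsOpenImmersion.of_isLocalization
    (AddMonoidAlgebra.single m (1 : ℂ) : ConeRing p N σ.1)

theorem Fan.mem_range_diagram_map (Φ : Fan N) {τ σ : Φ.cones} (h : τ ⟶ σ)
    (m : dualMonoid p N σ.1) (hm : ∀ x, x ∈ τ.1 ↔ x ∈ σ.1 ∧ p x m = 0)
    (x : (Φ.diagram p).obj σ) :
    x ∈ Set.range ((Φ.diagram p).map h) ↔
      (AddMonoidAlgebra.single m (1 : ℂ) : ConeRing p N σ.1) ∉
        PrimeSpectrum.asIdeal (R := ConeRing p N σ.1) x := by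
  obtain ⟨s, -, hs⟩ := Φ.rational σ.1 σ.2
  let _ := (coneRingMap p N (leOfHom h)).toRingHom.toAlgebra
  have := isLocalization_coneRing p N (leOfHom h) hs m hm
  have h1 := PrimeSpectrum.localization_away_comap_range (ConeRing p N τ.1)
    (AddMonoidAlgebra.single m (1 : ℂ) : ConeRing p N σ.1)
  exact Set.ext_iff.1 h1 x

instance (Φ : Fan N) : (Φ.diagram p ⋙ Scheme.forget).IsLocallyDirected := by
  constructor
  intro i j k fi fj xi xj hx
  replace hx : (Φ.diagram p).map fi xi = (Φ.diagram p).map fj xj := hx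
  have hmem : i.1 ⊓ j.1 ∈ Φ.cones := Φ.face_mem _ i.2 _ (Φ.inf_face _ i.2 _ j.2).1
  let l : Φ.cones := ⟨i.1 ⊓ j.1, hmem⟩
  let fli : l ⟶ i := homOfLE (show i.1 ⊓ j.1 ≤ i.1 from inf_le_left)
  let flj : l ⟶ j := homOfLE (show i.1 ⊓ j.1 ≤ j.1 from inf_le_right)
  obtain ⟨mi, hmi⟩ := Φ.exists_monomial p k.2 (Φ.isConeFace_of_le k.2 i.2 (leOfHom fi))
  obtain ⟨mj, hmj⟩ := Φ.exists_monomial p k.2 (Φ.isConeFace_of_le k.2 j.2 (leOfHom fj))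
  have hl : ∀ x, x ∈ l.1 ↔ x ∈ k.1 ∧ p x (mi + mj : dualMonoid p N k.1) = 0 := by
    intro x
    rw [Submodule.mem_inf, hmi, hmj, AddSubmonoid.coe_add, map_add]
    constructor
    · rintro ⟨⟨h1, h2⟩, -, h3⟩
      exact ⟨h1, by rw [h2, h3, add_zero]⟩
    · rintro ⟨h1, h2⟩
      have h3 := mi.2.2 x h1
      have h4 := mj.2.2 x h1
      exact ⟨⟨h1, by linarith⟩, h1, by linarith⟩
  have h1 := (Φ.mem_range_diagram_map p fi mi hmi _).1 ⟨xi, rfl⟩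
  have h2 := (Φ.mem_range_diagram_map p fj mj hmj _).1 ⟨xj, rfl⟩
  rw [← hx] at h2
  obtain ⟨z, hz⟩ := (Φ.mem_range_diagram_map p (fli ≫ fi) (mi + mj) hl
    ((Φ.diagram p).map fi xi)).2 (by
      have h3 := PrimeSpectrum.isPrime (R := ConeRing p N k.1) ((Φ.diagram p).map fi xi)
      have h4 := h3.mul_notMem h1 h2
      rwa [AddMonoidAlgebra.single_mul_single, mul_one] at h4)
  have inj : ∀ {a b : Φ.cones} (f : a ⟶ b), Function.Injective ((Φ.diagram p).map f) :=
    fun f => ((Φ.diagram p).map f).isOpenEmbedding.injective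
  refine ⟨l, fli, flj, z, ?_, ?_⟩
  · change (Φ.diagram p).map fli z = xi
    apply inj fi
    rw [← hz, Functor.map_comp, Scheme.Hom.comp_apply]
  · change (Φ.diagram p).map flj z = xj
    apply inj fj
    rw [← hx, ← hz, ← Scheme.Hom.comp_apply, ← Functor.map_comp]
    rfl

/-- The underlying scheme of the toric variety of a fan: the affine toric varieties `U_σ` glued
along the open immersions `U_τ → U_σ` for `τ` a face of `σ`. -/
abbrev Fan.scheme (Φ : Fan N) : Scheme.{0} := colimit (Φ.diagram p)

/-- The structure morphism of the toric variety of a fan. -/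
def Fan.structureMap (Φ : Fan N) : Φ.scheme p ⟶ Spec (CommRingCat.of ℂ) :=
  colimit.desc (Φ.diagram p)
    { pt := Spec (CommRingCat.of ℂ)
      ι :=
        { app := fun σ => Spec.map (CommRingCat.ofHom (algebraMap ℂ (ConeRing p N σ.1)))
          naturality := by
            intro τ σ h
            change Spec.map _ ≫ Spec.map _ = Spec.map _ ≫ 𝟙 _
            rw [Category.comp_id, ← Spec.map_comp, ← CommRingCat.ofHom_comp]
            congr 2
            exact (coneRingMap p N (leOfHom h)).comp_algebraMap } }

/-- The toric variety of a fan, as a scheme over `ℂ`. -/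
def Fan.toricVariety (Φ : Fan N) : Over (Spec (CommRingCat.of ℂ)) :=
  Over.mk (Φ.structureMap p)

/-! ### The torus action -/

/-- The group of complex points of the torus with character lattice `M` dual to `N`. -/
abbrev Torus (p : V →ₗ[ℝ] W →ₗ[ℝ] ℝ) (N : Submodule ℤ V) : Type :=
  Multiplicative (dualLattice p N) →* ℂˣ

/-- A point `t` of the torus acts on `ℂ[σ^∨ ∩ M]` by `χ^m ↦ t(m) χ^m`. -/
def coneRingTwist (t : Torus p N) (σ : PointedCone ℝ V) : ConeRing p N σ →ₐ[ℂ] ConeRing p N σ :=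
  AddMonoidAlgebra.lift ℂ _ _
    { toFun := fun m => AddMonoidAlgebra.single m.toAdd
        ((t (Multiplicative.ofAdd ⟨(m.toAdd : W), m.toAdd.2.1⟩) : ℂˣ) : ℂ)
      map_one' := by
        have h : t (Multiplicative.ofAdd (0 : dualLattice p N)) = 1 := map_one t
        rw [AddMonoidAlgebra.one_def]
        congr 1
        exact congrArg Units.val h
      map_mul' := by
        intro a b
        rw [AddMonoidAlgebra.single_mul_single, ← Units.val_mul, ← map_mul]
        rfl }

theorem coneRingTwist_single (t : Torus p N) (σ : PointedCone ℝ V) (m : dualMonoid p N σ) (c : ℂ) :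
    coneRingTwist p t σ (AddMonoidAlgebra.single m c) =
      AddMonoidAlgebra.single m (c * (t (Multiplicative.ofAdd ⟨(m : W), m.2.1⟩) : ℂˣ)) := by
  rw [coneRingTwist, AddMonoidAlgebra.lift_single]
  simp

theorem coneRingTwist_one (σ : PointedCone ℝ V) :
    coneRingTwist p (1 : Torus p N) σ = AlgHom.id ℂ _ :=
  coneRing_algHom_ext p N fun m => by rw [coneRingTwist_single]; simp

theorem coneRingTwist_mul (t u : Torus p N) (σ : PointedCone ℝ V) :
    coneRingTwist p (t * u) σ = (coneRingTwist p t σ).comp (coneRingTwist p u σ) :=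
  coneRing_algHom_ext p N fun m => by
    rw [AlgHom.comp_apply, coneRingTwist_single, coneRingTwist_single, coneRingTwist_single]
    simp [mul_comm]

theorem coneRingTwist_comp_coneRingMap (t : Torus p N) {τ σ : PointedCone ℝ V} (h : τ ≤ σ) :
    (coneRingTwist p t τ).comp (coneRingMap p N h) =
      (coneRingMap p N h).comp (coneRingTwist p t σ) :=
  coneRing_algHom_ext p N fun m => by
    rw [AlgHom.comp_apply, AlgHom.comp_apply, coneRingMap_single, coneRingTwist_single,
      coneRingTwist_single, coneRingMap_single]
    rfl

/-- The action of a point of the torus on the charts. -/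
def Fan.twist (Φ : Fan N) (t : Torus p N) : Φ.diagram p ⟶ Φ.diagram p where
  app σ := Spec.map (CommRingCat.ofHom (coneRingTwist p t σ.1).toRingHom)
  naturality {τ σ} h := by
    change Spec.map _ ≫ Spec.map _ = Spec.map _ ≫ Spec.map _
    rw [← Spec.map_comp, ← Spec.map_comp, ← CommRingCat.ofHom_comp, ← CommRingCat.ofHom_comp]
    congr 2
    exact congrArg AlgHom.toRingHom (coneRingTwist_comp_coneRingMap p t (leOfHom h)).symm

/-- The action of a point of the torus on the toric variety. -/
def Fan.translation (Φ : Fan N) (t : Torus p N) : Φ.toricVariety p ⟶ Φ.toricVariety p :=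
  Over.homMk (colimMap (Φ.twist p t)) (by
    refine colimit.hom_ext fun σ => ?_
    change colimit.ι _ σ ≫ colimMap _ ≫ Φ.structureMap p = colimit.ι _ σ ≫ Φ.structureMap p
    rw [ι_colimMap_assoc, Fan.structureMap, colimit.ι_desc]
    change Spec.map _ ≫ Spec.map _ = Spec.map _
    rw [← Spec.map_comp, ← CommRingCat.ofHom_comp]
    congr 2
    exact (coneRingTwist p t σ.1).comp_algebraMap)

theorem Fan.translation_one (Φ : Fan N) : Φ.translation p 1 = 𝟙 _ := by
  ext1
  refine colimit.hom_ext fun σ => ?_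
  change colimit.ι _ σ ≫ colimMap _ = colimit.ι _ σ ≫ 𝟙 _
  rw [ι_colimMap, Category.comp_id]
  have h : (Φ.twist p 1).app σ = 𝟙 _ := by
    change Spec.map _ = 𝟙 (Spec _)
    rw [← Spec.map_id, ← CommRingCat.ofHom_id]
    congr 2
    exact congrArg AlgHom.toRingHom (coneRingTwist_one p σ.1)
  rw [h, Category.id_comp]

theorem Fan.translation_mul (Φ : Fan N) (t u : Torus p N) :
    Φ.translation p (t * u) = Φ.translation p t ≫ Φ.translation p u := by
  ext1
  refine colimit.hom_ext fun σ => ?_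
  change colimit.ι _ σ ≫ colimMap _ = colimit.ι _ σ ≫ colimMap _ ≫ colimMap _
  rw [ι_colimMap, ι_colimMap_assoc, ι_colimMap, ← Category.assoc]
  congr 1
  change Spec.map _ = Spec.map _ ≫ Spec.map _
  rw [← Spec.map_comp, ← CommRingCat.ofHom_comp]
  congr 2
  exact congrArg AlgHom.toRingHom (coneRingTwist_mul p t u σ.1)

/-- The action of the torus on the toric variety. -/
def Fan.torusAction (Φ : Fan N) : Torus p N →* Aut (Φ.toricVariety p) where
  toFun t :=
    { hom := Φ.translation p t
      inv := Φ.translation p t⁻¹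
      hom_inv_id := by
        rw [← Fan.translation_mul, ← Fan.translation_one]
        exact congrArg _ (mul_inv_cancel t)
      inv_hom_id := by
        rw [← Fan.translation_mul, ← Fan.translation_one]
        exact congrArg _ (inv_mul_cancel t) }
  map_one' := by
    ext1
    exact Φ.translation_one p
  map_mul' t u := by
    ext1
    change Φ.translation p (t * u) = Φ.translation p u ≫ Φ.translation p t
    rw [← Fan.translation_mul]
    exact congrArg _ (mul_comm t u)

/-- The point `m ↦ exp(2πi⟨v, m⟩)` of the torus. -/
def torusExp (v : V) : Torus p N where
  toFun m := Units.mk0 (Complex.exp (2 * Real.pi * Complex.I * (p v (m.toAdd : W) : ℝ)))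
    (Complex.exp_ne_zero _)
  map_one' := by
    ext
    simp
  map_mul' a b := by
    ext
    simp [mul_add, Complex.exp_add]

/-- For a lattice `N'` containing `N`, the embedding of the group `N' / N` in the torus of `N`,
with image the kernel of the map from the torus of `N` to the torus of `N'`. -/
def quotientToTorus (N' : Submodule ℤ V) :
    Multiplicative (N' ⧸ N.submoduleOf N') →* Torus p N :=
  AddMonoidHom.toMultiplicativeLeft
    (QuotientAddGroup.lift (N.submoduleOf N').toAddSubgroup
      { toFun := fun v => Additive.ofMul (torusExp p (v : V))
        map_zero' := by
          apply Additive.toMul.injective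
          ext m
          simp [torusExp]
        map_add' := fun a b => by
          apply Additive.toMul.injective
          ext m
          simp [torusExp, mul_add, Complex.exp_add] }
      (by
        intro v hv
        apply Additive.toMul.injective
        refine MonoidHom.ext fun m => Units.ext ?_
        obtain ⟨k, hk⟩ := m.toAdd.2 v hv
        simp [torusExp, hk]
        rw [mul_comm]
        exact Complex.exp_int_mul_two_pi_mul_I k))

/-- The action of `N' / N` on the toric variety of a fan in `N`, for a lattice `N'`
containing `N`. -/
def Fan.latticeAction (Φ : Fan N) (N' : Submodule ℤ V) :
    Multiplicative (N' ⧸ N.submoduleOf N') →* Aut (Φ.toricVariety p) :=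
  (Φ.torusAction p).comp (quotientToTorus p N')

end Toric

/-! ### Quotients -/

/-- `π : X ⟶ Y` is the geometric quotient of `X` by the action `a` of the group `G`:
it is invariant, its fibres are the orbits, `Y` carries the quotient topology, and the functions
on an open subset of `Y` are the invariant functions on its preimage. These conditions determine
`Y` and `π` up to unique isomorphism. -/
structure IsGeometricQuotient {S : Scheme.{0}} {G : Type} [Group G] {X Y : Over S}
    (a : G →* Aut X) (π : X ⟶ Y) : Prop where
  invariant : ∀ g, (a g).hom ≫ π = π
  isQuotientMap : Topology.IsQuotientMap π.left
  orbit : ∀ x x' : X.left, π.left x = π.left x' → ∃ g, (a g).hom.left x = x'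
  injective : ∀ U : Y.left.Opens, Function.Injective (π.left.app U)
  surjective : ∀ (U : Y.left.Opens) (f : Γ(X.left, π.left ⁻¹ᵁ U)),
    (∀ g, ∀ h : π.left ⁻¹ᵁ U ≤ (a g).hom.left ⁻¹ᵁ (π.left ⁻¹ᵁ U),
      (a g).hom.left.appLE (π.left ⁻¹ᵁ U) (π.left ⁻¹ᵁ U) h f = f) →
    ∃ f' : Γ(Y.left, U), π.left.app U f' = f

/-! ### Batyrev-Borisov mirror pairs -/

section Mirror

variable {V W : Type} [NormedAddCommGroup V] [NormedSpace ℝ V] [FiniteDimensional ℝ V]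
  [NormedAddCommGroup W] [NormedSpace ℝ W] [FiniteDimensional ℝ W]

instance isPerfPair_flip (p : V →ₗ[ℝ] W →ₗ[ℝ] ℝ) [hp : p.IsPerfPair] : p.flip.IsPerfPair :=
  hp.flip

/-- The spanning fan of a reflexive polytope. -/
def IsReflexive.fan {p : V →ₗ[ℝ] W →ₗ[ℝ] ℝ} {N : Submodule ℤ V} {P : Set V}
    (hP : IsReflexive p N P) : Fan N :=
  spanningFan hP.isLatticePolytope hP.zero_mem_interior

/-- The spanning fan of the dual `P^∨` of a reflexive polytope, a fan in the dual lattice. -/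
def IsReflexive.dualFan {p : V →ₗ[ℝ] W →ₗ[ℝ] ℝ} {N : Submodule ℤ V} {P : Set V}
    (hP : IsReflexive p N P) : Fan (dualLattice p N) :=
  spanningFan hP.dual_isLatticePolytope (zero_mem_interior_polarDual p hP.isLatticePolytope)

/-- The sublattice `M̄` of the dual lattice spanned by the vertices of `P^∨`. -/
abbrev primitiveLattice (p : V →ₗ[ℝ] W →ₗ[ℝ] ℝ) (P : Set V) : Submodule ℤ W :=
  vertexLattice (polarDual p P)

/-- The spanning fan of the primitive dual `Q` of a reflexive polytope `P`: the polytope `P^∨`,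
regarded as a lattice polytope in the lattice `M̄`. -/
def IsReflexive.primitiveDualFan {p : V →ₗ[ℝ] W →ₗ[ℝ] ℝ} {N : Submodule ℤ V} {P : Set V}
    (hP : IsReflexive p N P) : Fan (primitiveLattice p P) :=
  spanningFan
    (hP.dual_isLatticePolytope.vertexLattice
      (zero_mem_interior_polarDual p hP.isLatticePolytope))
    (zero_mem_interior_polarDual p hP.isLatticePolytope)

/-- Two toric varieties form a Batyrev-Borisov mirror pair if they are the toric varieties
`X_R` and `X_{R^∨}` of a reflexive polytope `R` and its dual. -/
def IsBatyrevBorisovMirrorPair (X Y : Over (Spec (CommRingCat.of ℂ))) : Prop :=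
  ∃ (V W : Type) (_ : NormedAddCommGroup V) (_ : NormedSpace ℝ V) (_ : FiniteDimensional ℝ V)
    (_ : NormedAddCommGroup W) (_ : NormedSpace ℝ W) (_ : FiniteDimensional ℝ W)
    (p : V →ₗ[ℝ] W →ₗ[ℝ] ℝ) (_ : p.IsPerfPair) (N : Submodule ℤ V) (R : Set V)
    (hR : IsReflexive p N R),
    Nonempty (X ≅ hR.fan.toricVariety p) ∧ Nonempty (Y ≅ hR.dualFan.toricVariety p.flip)

end Mirror

end ToricMirror

end

open CategoryTheory CategoryTheory.Limits AlgebraicGeometry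

noncomputable section

set_option linter.unusedSectionVars false

namespace ToricMirror

/-! ### Dual lattices -/

section Lattice

variable {V W : Type} [NormedAddCommGroup V] [NormedSpace ℝ V] [FiniteDimensional ℝ V]
  [NormedAddCommGroup W] [NormedSpace ℝ W] [FiniteDimensional ℝ W]

/-! Everything rests on one fact about toric varieties. Keep the cones of a fan fixed and enlarge
its lattice from `N` to `N'`, so that the dual lattice shrinks from `M` to `M'`. The resulting toric
morphism is the geometric quotient by the finite group `N' / N`. On the chart of a cone `σ` it is
dual to the inclusion `ℂ[σ^∨ ∩ M'] ⊆ ℂ[σ^∨ ∩ M]`. The class of `v` multiplies `χ^m` by `exp(2πi⟨v,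
m⟩)`, so `χ^m` is fixed by the whole group exactly when `m ∈ M'`; hence the smaller ring is the ring
of invariants (`mem_range_latticeRingMap`). Both varieties are glued from the same cones and the
preimage of each chart is the corresponding chart, so the affine quotients assemble into a global
one (`IsGeometricQuotient.of_charts`, `Fan.isGeometricQuotient_latticeMap`).

Apply this to the spanning fan of `P` for `N ⊆ N₁`, and to that of `P^∨` for `M̄ ⊆ M₁`. The
quotients are the toric varieties of these fans in `N₁` and in `M₁`. The polytope `P` remains
reflexive in `N₁`: its vertices lie in `N ⊆ N₁`, the dual polytope does not change, and the vertices
of `P^∨` lie in `M̄ ⊆ M₁ = N₁^∨` (`IsReflexive.inLattice`). So the mirror pair comes from `R = P` in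
the lattice `N₁`. -/

theorem IsLattice.exists_basis {N : Submodule ℤ V} (hN : IsLattice N) :
    ∃ (ι : Type) (_ : Fintype ι) (_ : DecidableEq ι) (b : Module.Basis ι ℝ V),
      N = Submodule.span ℤ (Set.range b) := by
  classical
  obtain ⟨hd, hz⟩ := hN
  have : Module.Finite ℤ N := ZLattice.module_finite ℝ N
  have : Module.Free ℤ N := ZLattice.module_free ℝ N
  let bZ := Module.Free.chooseBasis ℤ N
  exact ⟨_, inferInstance, inferInstance, bZ.ofZLatticeBasis ℝ N,
    (bZ.ofZLatticeBasis_span ℝ N).symm⟩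

theorem isLattice_span {ι : Type} [Fintype ι] (b : Module.Basis ι ℝ V) :
    IsLattice (Submodule.span ℤ (Set.range b)) :=
  ⟨inferInstance, inferInstance⟩

/-- The basis dual to `b` with respect to a perfect pairing. -/
def pairingDualBasis (p : V →ₗ[ℝ] W →ₗ[ℝ] ℝ) [p.IsPerfPair] {ι : Type} [Fintype ι]
    [DecidableEq ι] (b : Module.Basis ι ℝ V) : Module.Basis ι ℝ W :=
  b.dualBasis.map p.flip.toPerfPair.symm

theorem pairing_pairingDualBasis (p : V →ₗ[ℝ] W →ₗ[ℝ] ℝ) [p.IsPerfPair] {ι : Type} [Fintype ι]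
    [DecidableEq ι] (b : Module.Basis ι ℝ V) (i j : ι) :
    p (b i) (pairingDualBasis p b j) = if i = j then 1 else 0 := by
  have h : p (b i) (pairingDualBasis p b j) = b.dualBasis j (b i) := by
    rw [pairingDualBasis, Module.Basis.map_apply]
    exact p.apply_toPerfPair_flip _ _
  rw [h, Module.Basis.dualBasis_apply_self]

theorem repr_eq_pairing (p : V →ₗ[ℝ] W →ₗ[ℝ] ℝ) {ι : Type} [Fintype ι] [DecidableEq ι]
    (b : Module.Basis ι ℝ V) (c : Module.Basis ι ℝ W)
    (h : ∀ i j, p (b i) (c j) = if i = j then 1 else 0) (w : W) (i : ι) :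
    c.repr w i = p (b i) w := by
  conv_rhs => rw [← c.sum_repr w]
  simp only [map_sum, map_smul, h, smul_eq_mul, mul_ite, mul_one, mul_zero, Finset.sum_ite_eq,
    Finset.mem_univ, if_true]

/-- The coordinates of `w` in `c` are its pairings with the vectors of `b`, and integrality on `b`
propagates to its integer span. -/
theorem dualLattice_span (p : V →ₗ[ℝ] W →ₗ[ℝ] ℝ) {ι : Type} [Fintype ι] [DecidableEq ι]
    (b : Module.Basis ι ℝ V) (c : Module.Basis ι ℝ W)
    (h : ∀ i j, p (b i) (c j) = if i = j then 1 else 0) :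
    dualLattice p (Submodule.span ℤ (Set.range b)) = Submodule.span ℤ (Set.range c) := by
  ext w
  rw [c.mem_span_iff_repr_mem ℤ]
  constructor
  · intro hw i
    obtain ⟨k, hk⟩ := hw (b i) (Submodule.subset_span ⟨i, rfl⟩)
    exact ⟨k, by rw [repr_eq_pairing p b c h, hk]; simp⟩
  · intro hw v hv
    induction hv using Submodule.span_induction with
    | mem x hx =>
      obtain ⟨i, rfl⟩ := hx
      obtain ⟨k, hk⟩ := hw i
      exact ⟨k, by rw [← repr_eq_pairing p b c h, ← hk]; simp⟩
    | zero => exact ⟨0, by simp⟩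
    | add x y _ _ hx hy =>
      obtain ⟨k, hk⟩ := hx
      obtain ⟨l, hl⟩ := hy
      exact ⟨k + l, by simp [hk, hl]⟩
    | smul a x _ hx =>
      obtain ⟨k, hk⟩ := hx
      exact ⟨a * k, by simp [hk]⟩

theorem IsLattice.dualLattice (p : V →ₗ[ℝ] W →ₗ[ℝ] ℝ) [p.IsPerfPair] {N : Submodule ℤ V}
    (hN : IsLattice N) : IsLattice (dualLattice p N) := by
  obtain ⟨ι, _, _, b, rfl⟩ := hN.exists_basis
  rw [dualLattice_span p b _ (pairing_pairingDualBasis p b)]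
  exact isLattice_span _

/-- Duality of bases is symmetric under flipping the pairing. This is what allows an intermediate
lattice `M₁` to be written as the dual of some `N₁`. -/
theorem IsLattice.dualLattice_dualLattice (p : V →ₗ[ℝ] W →ₗ[ℝ] ℝ) [p.IsPerfPair]
    {N : Submodule ℤ V} (hN : IsLattice N) :
    ToricMirror.dualLattice p.flip (ToricMirror.dualLattice p N) = N := by
  obtain ⟨ι, _, _, b, rfl⟩ := hN.exists_basis
  rw [dualLattice_span p b _ (pairing_pairingDualBasis p b)]
  exact dualLattice_span p.flip _ _ fun i j => by
    simp [pairing_pairingDualBasis, eq_comm]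

theorem dualLattice_anti (p : V →ₗ[ℝ] W →ₗ[ℝ] ℝ) {N N' : Submodule ℤ V} (h : N ≤ N') :
    dualLattice p N' ≤ dualLattice p N :=
  fun _ hw v hv => hw v (h hv)

/-- Discreteness is inherited from the larger lattice and spanning from the smaller one. -/
theorem IsLattice.of_le_of_le {L L₁ L₂ : Submodule ℤ V} (hL : IsLattice L) (hL₂ : IsLattice L₂)
    (h : L ≤ L₁) (h' : L₁ ≤ L₂) : IsLattice L₁ := by
  obtain ⟨_, hz⟩ := hL
  obtain ⟨hd, -⟩ := hL₂
  refine ⟨DiscreteTopology.of_subset hd h', ?_⟩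
  let _ : DiscreteTopology L₁ := DiscreteTopology.of_subset hd h'
  exact ⟨top_le_iff.1 (hz.span_top.ge.trans (Submodule.span_mono h))⟩

theorem IsLattice.finite_quotient {N N' : Submodule ℤ V} (hN : IsLattice N) (hN' : IsLattice N')
    (h : N ≤ N') : Finite (N' ⧸ N.submoduleOf N') := by
  obtain ⟨_, _⟩ := hN
  obtain ⟨_, _⟩ := hN'
  have : Module.Finite ℤ N' := ZLattice.module_finite ℝ N'
  have : Module.Free ℤ N' := ZLattice.module_free ℝ N'
  refine Submodule.finiteQuotientOfFreeOfRankEq _ ?_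
  rw [LinearEquiv.finrank_eq (Submodule.submoduleOfEquivOfLe h), ZLattice.rank ℝ N,
    ZLattice.rank ℝ N']

end Lattice

/-! ### A local criterion for geometric quotients -/

section Descent

variable {X Y : Scheme.{0}} {G : Type} (φ : G → (X ⟶ X)) (π : X ⟶ Y) (hφ : ∀ g, φ g ≫ π = π)

include hφ in
theorem preimage_le_of_invariant (g : G) (U : Y.Opens) :
    π ⁻¹ᵁ U ≤ φ g ⁻¹ᵁ (π ⁻¹ᵁ U) := by
  rw [← Scheme.Hom.comp_preimage, hφ]

/-- Every section of `X` over the preimage of `U` which is invariant under all `φ g` descends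
to a section of `Y` over `U`. -/
def SectionsDescend (U : Y.Opens) : Prop :=
  ∀ s : Γ(X, π ⁻¹ᵁ U),
    (∀ g, (φ g).appLE (π ⁻¹ᵁ U) (π ⁻¹ᵁ U) (preimage_le_of_invariant φ π hφ g U) s = s) →
    ∃ t : Γ(Y, U), π.app U t = s

/-- The non-vanishing locus of a section in the kernel has empty preimage, so by surjectivity it is
empty; on a reduced scheme the section is then zero. -/
theorem app_injective_of_surjective [IsReduced Y] (hπ : Function.Surjective π) (U : Y.Opens) :
    Function.Injective (π.app U) := by
  rw [injective_iff_map_eq_zero]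
  intro t ht
  rw [← basicOpen_eq_bot_iff, eq_bot_iff]
  intro y hy
  obtain ⟨x, rfl⟩ := hπ y
  have h1 : x ∈ π ⁻¹ᵁ Y.basicOpen t := hy
  rw [Scheme.preimage_basicOpen, ht, Scheme.basicOpen_zero] at h1
  exact h1.elim

theorem appLE_restrict {Z T : Scheme.{0}} (f : Z ⟶ T) {U U' : T.Opens} {V V' : Z.Opens} (hU : U' ≤ U)
    (hV : V' ≤ V) (h : V ≤ f ⁻¹ᵁ U) (h' : V' ≤ f ⁻¹ᵁ U') (s : Γ(T, U)) :
    Z.presheaf.map (homOfLE hV).op (f.appLE U V h s) =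
      f.appLE U' V' h' (T.presheaf.map (homOfLE hU).op s) := by
  rw [← CommRingCat.comp_apply, ← CommRingCat.comp_apply, Scheme.Hom.appLE_map,
    Scheme.Hom.map_appLE]

theorem app_restrict {Z T : Scheme.{0}} (f : Z ⟶ T) {U U' : T.Opens} (hU : U' ≤ U) (s : Γ(T, U)) :
    Z.presheaf.map (homOfLE (f.preimage_mono hU)).op (f.app U s) =
      f.app U' (T.presheaf.map (homOfLE hU).op s) := by
  rw [Scheme.Hom.app_eq_appLE, Scheme.Hom.app_eq_appLE]
  exact appLE_restrict f hU _ _ _ s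

/-- Taking invariants of a finite group commutes with inverting an invariant function. Write `s = a
/ r ^ n`; then `a` is invariant up to a power of `r`, and clearing that power gives an invariant
numerator, which descends. -/
theorem SectionsDescend.basicOpen [Finite G] {U : Y.Opens} (hU : IsAffineOpen U)
    (hV : IsAffineOpen (π ⁻¹ᵁ U)) (h : SectionsDescend φ π hφ U) (r : Γ(Y, U)) :
    SectionsDescend φ π hφ (Y.basicOpen r) := by
  intro s hs
  have hle : Y.basicOpen r ≤ U := Y.basicOpen_le r
  have hle' : π ⁻¹ᵁ Y.basicOpen r ≤ π ⁻¹ᵁ U := π.preimage_mono hle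
  set r' : Γ(X, π ⁻¹ᵁ U) := π.app U r with hr'
  let resX := X.presheaf.map (homOfLE hle').op
  let resY := Y.presheaf.map (homOfLE hle).op
  have hpre : π ⁻¹ᵁ Y.basicOpen r = X.basicOpen r' := Scheme.preimage_basicOpen π r
  have hinvr : ∀ g, (φ g).appLE (π ⁻¹ᵁ U) (π ⁻¹ᵁ U) (preimage_le_of_invariant φ π hφ g U) r' =
      r' := by
    intro g
    rw [hr', Scheme.Hom.app_eq_appLE, ← CommRingCat.comp_apply, Scheme.Hom.appLE_comp_appLE]
    simp only [hφ]
  let _ : Algebra Γ(X, π ⁻¹ᵁ U) Γ(X, π ⁻¹ᵁ Y.basicOpen r) := resX.hom.toAlgebra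
  have hres : ∀ x, algebraMap Γ(X, π ⁻¹ᵁ U) Γ(X, π ⁻¹ᵁ Y.basicOpen r) x = resX x := fun _ => rfl
  have hloc : IsLocalization.Away r' Γ(X, π ⁻¹ᵁ Y.basicOpen r) :=
    hV.isLocalization_of_eq_basicOpen r' (homOfLE hle') hpre
  obtain ⟨n, a, ha⟩ := IsLocalization.Away.surj r' s
  rw [hres, hres] at ha
  -- Invariance of `s` only shows that `a` and its translate agree after `r'` is inverted, hence
  -- after multiplication by some power of `r'`.
  have hga : ∀ g, ∃ k : ℕ, r' ^ k * (φ g).appLE (π ⁻¹ᵁ U) (π ⁻¹ᵁ U)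
      (preimage_le_of_invariant φ π hφ g U) a = r' ^ k * a := by
    intro g
    refine IsLocalization.Away.exists_of_eq (S := Γ(X, π ⁻¹ᵁ Y.basicOpen r)) r' ?_
    rw [hres, hres, appLE_restrict (φ g) hle' hle' _ (preimage_le_of_invariant φ π hφ g _)]
    change _ = resX a
    change (φ g).appLE _ _ _ (resX a) = _
    rw [← ha, map_mul, hs g, map_pow]
    congr 2
    have := appLE_restrict (φ g) hle' hle' (preimage_le_of_invariant φ π hφ g U)
      (preimage_le_of_invariant φ π hφ g _) r'
    rw [hinvr] at this
    exact this.symm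
  choose k hk using hga
  cases nonempty_fintype G
  -- One exponent that works for all group elements at once; here finiteness of `G` is essential.
  let K := Finset.univ.sup k
  obtain ⟨b, hb⟩ := h (r' ^ K * a) (by
    intro g
    rw [map_mul, map_pow, hinvr]
    obtain ⟨j, hj⟩ := Nat.exists_eq_add_of_le (Finset.le_sup (f := k) (Finset.mem_univ g))
    change r' ^ (Finset.univ.sup k) * _ = r' ^ (Finset.univ.sup k) * _
    rw [hj, pow_add, mul_right_comm, hk, mul_right_comm])
  have hu : IsUnit (resY r) := by
    have := hU.isLocalization_basicOpen r
    exact IsLocalization.Away.algebraMap_isUnit (S := Γ(Y, Y.basicOpen r)) r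
  obtain ⟨u, hu⟩ := hu
  have hπu : π.app _ (u : Γ(Y, Y.basicOpen r)) = resX r' := by
    rw [hu]; exact (app_restrict π hle r).symm
  -- From `a = s * r' ^ n` and `π^* b = r' ^ K * a` one gets `s = π^* b / r' ^ (K + n)`.
  refine ⟨resY b * (↑(u⁻¹ ^ (K + n)) : Γ(Y, Y.basicOpen r)), ?_⟩
  have h1 : π.app _ (resY b) = resX (r' ^ K * a) := by
    rw [← hb]; exact (app_restrict π hle b).symm
  have h2 : resX (r' ^ K * a) = s * π.app _ (↑(u ^ (K + n)) : Γ(Y, Y.basicOpen r)) := by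
    rw [map_mul, ← ha, Units.val_pow_eq_pow_val, map_pow, map_pow, hπu]
    ring
  rw [map_mul, h1, h2, mul_assoc, ← map_mul, ← Units.val_mul, ← mul_pow, mul_inv_cancel, one_pow,
    Units.val_one, map_one, mul_one]

/-- Injectivity of pullback makes local descents unique, so they agree on overlaps and glue. -/
theorem SectionsDescend.of_forall_exists (hinj : ∀ U, Function.Injective (π.app U)) (U : Y.Opens)
    (h : ∀ y ∈ U, ∃ U' ≤ U, y ∈ U' ∧ SectionsDescend φ π hφ U') : SectionsDescend φ π hφ U := by
  intro s hs
  choose! U' hle hmem hU' using h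
  let ι := {y // y ∈ U}
  have hloc : ∀ i : ι, ∃ t : Γ(Y, U' i.1), π.app (U' i.1) t =
      X.presheaf.map (homOfLE (π.preimage_mono (hle i.1 i.2))).op s := by
    intro i
    refine hU' i.1 i.2 _ fun g => ?_
    rw [← appLE_restrict (φ g) (π.preimage_mono (hle i.1 i.2)) (π.preimage_mono (hle i.1 i.2))
      (preimage_le_of_invariant φ π hφ g U), hs g]
  choose t ht using hloc
  obtain ⟨T, hT, -⟩ := Y.sheaf.existsUnique_gluing' (fun i : ι => U' i.1) U
    (fun i => homOfLE (hle i.1 i.2))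
    (fun y hy => TopologicalSpace.Opens.mem_iSup.2 ⟨⟨y, hy⟩, hmem y hy⟩) t (by
      intro i j
      apply hinj
      refine (app_restrict π inf_le_left (t i)).symm.trans
        (Eq.trans ?_ (app_restrict π inf_le_right (t j)))
      rw [ht, ht, ← CommRingCat.comp_apply, ← CommRingCat.comp_apply, ← Functor.map_comp,
        ← Functor.map_comp]
      rfl)
  refine ⟨T, ?_⟩
  refine X.sheaf.eq_of_locally_eq' (fun i : ι => π ⁻¹ᵁ (U' i.1)) _
    (fun i => homOfLE (π.preimage_mono (hle i.1 i.2)))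
    (fun x hx => TopologicalSpace.Opens.mem_iSup.2 ⟨⟨π x, hx⟩, hmem _ hx⟩) _ _ fun i => ?_
  refine (app_restrict π (hle i.1 i.2) T).trans (Eq.trans ?_ (ht i))
  congr 1
  exact hT i

end Descent

/-! ### Affine charts of a quotient -/

section Charts

/-- Identifies sections over the image of an affine chart with the coordinate ring of the chart. -/
theorem appLE_ΓSpecIso_bijective {X : Scheme.{0}} {A : CommRingCat.{0}} (f : Spec A ⟶ X)
    [IsOpenImmersion f] {U : X.Opens} (hU : U = f.opensRange) (h : ⊤ ≤ f ⁻¹ᵁ U) :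
    Function.Bijective (f.appLE U ⊤ h ≫ (Scheme.ΓSpecIso A).hom) := by
  subst hU
  have h1 : IsIso (f.app f.opensRange) := f.isIso_app _ le_rfl
  have h2 : f.appLE f.opensRange ⊤ h = f.app f.opensRange ≫
      (Spec A).presheaf.map (eqToHom f.preimage_opensRange.symm).op := by
    rw [Scheme.Hom.app_eq_appLE, Scheme.Hom.appLE_map]
  rw [h2]
  exact ConcreteCategory.bijective_of_isIso _

/-- In chart coordinates, pullback of sections along `π` is the ring map `q`. It serves both for the
quotient map and for each group element acting on `X`. -/
theorem appLE_ΓSpecIso_naturality {X Y : Scheme.{0}} {A B : CommRingCat.{0}} (f : Spec A ⟶ X)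
    (h : Spec B ⟶ Y) (π : X ⟶ Y) (q : B ⟶ A) (hf : f ≫ π = Spec.map q ≫ h) {U : Y.Opens}
    {V : X.Opens} (hV : ⊤ ≤ f ⁻¹ᵁ V) (hU : ⊤ ≤ h ⁻¹ᵁ U) (hVU : V ≤ π ⁻¹ᵁ U) (t : Γ(Y, U)) :
    (f.appLE V ⊤ hV ≫ (Scheme.ΓSpecIso A).hom) (π.appLE U V hVU t) =
      q ((h.appLE U ⊤ hU ≫ (Scheme.ΓSpecIso B).hom) t) := by
  have e : (⊤ : (Spec A).Opens) ≤ Spec.map q ⁻¹ᵁ ⊤ := by simp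
  have h1 : (Spec.map q).appTop = (Spec.map q).appLE ⊤ ⊤ e :=
    Scheme.Hom.app_eq_appLE _
  have h2 : π.appLE U V hVU ≫ f.appLE V ⊤ hV = h.appLE U ⊤ hU ≫ (Spec.map q).appLE ⊤ ⊤ e := by
    refine (Scheme.Hom.appLE_comp_appLE f π U V ⊤ hVU hV).trans (Eq.trans ?_
      (Scheme.Hom.appLE_comp_appLE (Spec.map q) h U ⊤ ⊤ hU e).symm)
    simp only [hf]
  rw [← CommRingCat.comp_apply, ← CommRingCat.comp_apply, Category.assoc,
    ← Scheme.ΓSpecIso_naturality, ← Category.assoc, ← Category.assoc, h1, h2]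

variable {X Y : Scheme.{0}} {G : Type} [Group G] {A B : Type} [CommRing A] [CommRing B]
  [Algebra B A] [MulSemiringAction G A] [Algebra.IsInvariant B A G]

/-- In chart coordinates, descent of invariant sections is precisely the statement that every
`G`-invariant element of `A` comes from `B`. -/
theorem SectionsDescend.opensRange (φ : G → (X ⟶ X)) (π : X ⟶ Y) (hφ : ∀ g, φ g ≫ π = π)
    (f : Spec (CommRingCat.of A) ⟶ X) [IsOpenImmersion f]
    (h : Spec (CommRingCat.of B) ⟶ Y) [IsOpenImmersion h]
    (hf : f ≫ π = Spec.map (CommRingCat.ofHom (algebraMap B A)) ≫ h)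
    (hfφ : ∀ g, f ≫ φ g =
      Spec.map (CommRingCat.ofHom (MulSemiringAction.toRingHom G A g)) ≫ f)
    (hpre : π ⁻¹ᵁ h.opensRange = f.opensRange) :
    SectionsDescend φ π hφ h.opensRange := by
  intro s hs
  have hV : ⊤ ≤ f ⁻¹ᵁ (π ⁻¹ᵁ h.opensRange) := by rw [hpre, f.preimage_opensRange]
  have hU : ⊤ ≤ h ⁻¹ᵁ h.opensRange := by rw [h.preimage_opensRange]
  have hα := appLE_ΓSpecIso_bijective f hpre hV
  have hβ := appLE_ΓSpecIso_bijective h rfl hU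
  obtain ⟨b, hb⟩ := Algebra.IsInvariant.isInvariant (A := B) (G := G)
    ((f.appLE _ ⊤ hV ≫ (Scheme.ΓSpecIso (CommRingCat.of A)).hom) s) (fun g => by
      have := appLE_ΓSpecIso_naturality f f (φ g) _ (hfφ g) hV hV
        (preimage_le_of_invariant φ π hφ g _) s
      rw [hs g] at this
      exact this.symm)
  obtain ⟨t, rfl⟩ := hβ.2 b
  refine ⟨t, hα.1 ?_⟩
  rw [Scheme.Hom.app_eq_appLE, appLE_ΓSpecIso_naturality f h π _ hf hV hU]
  exact hb

/-- A ring is integral over its invariants under a finite group, so the map of spectra is closed,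
and lying over makes it surjective. -/
theorem isQuotientMap_comap [Finite G] [SMulCommClass G B A] [FaithfulSMul B A] :
    Topology.IsQuotientMap (PrimeSpectrum.comap (algebraMap B A)) := by
  have : Algebra.IsIntegral B A := Algebra.IsInvariant.isIntegral B A G
  refine IsClosedMap.isQuotientMap ?_ (PrimeSpectrum.continuous_comap _) ?_
  · exact PrimeSpectrum.isClosedMap_comap_of_isIntegral _ (algebraMap_isIntegral_iff.2 this)
  · exact this.comap_surjective

/-- A finite group acts transitively on the primes lying over a given prime of the invariant ring.
-/
theorem exists_comap_eq_of_comap_eq [Finite G] [SMulCommClass G B A] (x x' : PrimeSpectrum A)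
    (hx : PrimeSpectrum.comap (algebraMap B A) x = PrimeSpectrum.comap (algebraMap B A) x') :
    ∃ g : G, PrimeSpectrum.comap (MulSemiringAction.toRingHom G A g) x = x' := by
  obtain ⟨g, hg⟩ := Algebra.IsInvariant.exists_smul_of_under_eq B A G x.asIdeal x'.asIdeal
    (congrArg PrimeSpectrum.asIdeal hx)
  -- Pulling a prime back along `g⁻¹` is the same as translating it by `g`.
  refine ⟨g⁻¹, PrimeSpectrum.ext ?_⟩
  ext a
  rw [hg, Ideal.mem_pointwise_smul_iff_inv_smul_mem]
  rfl

end Charts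

/-- Each condition is local on `Y` once `hpre` identifies the preimage of a chart of `Y` with a
single chart of `X`. There the pair is `Spec A → Spec B` with `B` the invariants of `A`. Reducedness
of `Y` supplies injectivity on functions. -/
theorem IsGeometricQuotient.of_charts {S : Scheme.{0}} {G : Type} [Group G] [Finite G]
    {X Y : Over S} [AlgebraicGeometry.IsReduced Y.left] (a : G →* Aut X) (π : X ⟶ Y)
    (hπ : ∀ g, (a g).hom ≫ π = π) {ι : Type} (A B : ι → Type) [∀ i, CommRing (A i)]
    [∀ i, CommRing (B i)] [∀ i, Algebra (B i) (A i)] [∀ i, MulSemiringAction G (A i)]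
    [∀ i, SMulCommClass G (B i) (A i)] [∀ i, Algebra.IsInvariant (B i) (A i) G]
    [∀ i, FaithfulSMul (B i) (A i)]
    (f : ∀ i, Spec (CommRingCat.of (A i)) ⟶ X.left) [∀ i, IsOpenImmersion (f i)]
    (h : ∀ i, Spec (CommRingCat.of (B i)) ⟶ Y.left) [∀ i, IsOpenImmersion (h i)]
    (hf : ∀ i, f i ≫ π.left = Spec.map (CommRingCat.ofHom (algebraMap (B i) (A i))) ≫ h i)
    (hfa : ∀ i g, f i ≫ (a g).hom.left =
      Spec.map (CommRingCat.ofHom (MulSemiringAction.toRingHom G (A i) g)) ≫ f i)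
    (hpre : ∀ i x, π.left x ∈ Set.range (h i) → x ∈ Set.range (f i))
    (hcov : ∀ y, ∃ i, y ∈ Set.range (h i)) :
    IsGeometricQuotient a π := by
  have hφ : ∀ g, (a g).hom.left ≫ π.left = π.left := fun g => by
    rw [← Over.comp_left, hπ]
  have hfx : ∀ i x, π.left (f i x) = h i (PrimeSpectrum.comap (algebraMap (B i) (A i)) x) :=
    fun i x => by
      rw [← Scheme.Hom.comp_apply, hf]
      rfl
  have hpre' : ∀ i, π.left ⁻¹ᵁ (h i).opensRange = (f i).opensRange := by
    intro i
    ext x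
    refine ⟨hpre i x, ?_⟩
    rintro ⟨z, rfl⟩
    exact ⟨_, (hfx i z).symm⟩
  have hq : ∀ i, Topology.IsQuotientMap (PrimeSpectrum.comap (algebraMap (B i) (A i))) :=
    fun i => isQuotientMap_comap (G := G)
  have hsurj : Function.Surjective π.left := by
    intro y
    obtain ⟨i, z, rfl⟩ := hcov y
    obtain ⟨x, rfl⟩ := (hq i).surjective z
    exact ⟨f i x, hfx i x⟩
  have hdesc : ∀ U, SectionsDescend (fun g => (a g).hom.left) π.left hφ U := by
    intro U
    refine SectionsDescend.of_forall_exists _ _ hφ (app_injective_of_surjective _ hsurj) U ?_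
    intro y hy
    obtain ⟨i, hi⟩ := hcov y
    have hW : IsAffineOpen (h i).opensRange := isAffineOpen_opensRange (h i)
    -- Descent is known over a whole chart, and `U` need not contain one; a basic open of the chart
    -- inside `U` bridges the gap.
    obtain ⟨r, hr, hyr⟩ := hW.exists_basicOpen_le ⟨y, hy⟩ hi
    refine ⟨_, hr, hyr, SectionsDescend.basicOpen _ _ hφ hW ?_ ?_ r⟩
    · rw [hpre']
      exact isAffineOpen_opensRange (f i)
    · exact SectionsDescend.opensRange _ _ hφ (f i) (h i) (hf i) (hfa i) (hpre' i)
  refine ⟨hπ, ⟨Topology.isCoinducing_iff.2 fun T => ⟨fun hT => ?_, fun hT => hT.preimage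
    π.left.continuous⟩, hsurj⟩, ?_, app_injective_of_surjective _ hsurj, ?_⟩
  · refine isOpen_iff_mem_nhds.2 fun y hy => ?_
    obtain ⟨i, z, rfl⟩ := hcov y
    -- Openness of `T` near `y` is tested in the chart, where the map of spectra is already known to
    -- be a quotient map.
    refine (h i).isOpenEmbedding.image_mem_nhds.2 ?_ |> fun h => Filter.mem_of_superset h
      (Set.image_preimage_subset _ T)
    refine IsOpen.mem_nhds ((hq i).isOpen_preimage.1 ?_) hy
    have h1 : IsOpen (f i ⁻¹' (π.left ⁻¹' T)) := hT.preimage (f i).continuous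
    have h2 : f i ⁻¹' (π.left ⁻¹' T) =
        {x | h i (PrimeSpectrum.comap (algebraMap (B i) (A i)) x) ∈ T} := Set.ext fun x => by
      change π.left (f i x) ∈ T ↔ h i _ ∈ T
      rw [hfx]
    rw [h2] at h1
    exact h1
  · intro x x' hxx
    obtain ⟨i, hi⟩ := hcov (π.left x)
    obtain ⟨z, rfl⟩ := hpre i x hi
    obtain ⟨z', rfl⟩ := hpre i x' (hxx ▸ hi)
    rw [hfx, hfx] at hxx
    obtain ⟨g, hg⟩ := exists_comap_eq_of_comap_eq (G := G) z z'
      ((h i).isOpenEmbedding.injective hxx)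
    refine ⟨g, ?_⟩
    rw [← Scheme.Hom.comp_apply, hfa, Scheme.Hom.comp_apply, ← hg]
    rfl
  · intro U s hs
    exact hdesc U s fun g => hs g _

/-! ### Refining the lattice of a fan -/

section Refinement

variable {V W : Type} [NormedAddCommGroup V] [NormedSpace ℝ V] [FiniteDimensional ℝ V]
  [NormedAddCommGroup W] [NormedSpace ℝ W] [FiniteDimensional ℝ W]
  (p : V →ₗ[ℝ] W →ₗ[ℝ] ℝ) {N N' : Submodule ℤ V}

/-- A fan in `N`, regarded as a fan in a larger lattice `N'`. -/
abbrev Fan.inLattice (Φ : Fan N) (hN' : IsLattice N') (h : N ≤ N') : Fan N' where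
  isLattice := hN'
  cones := Φ.cones
  finite := Φ.finite
  rational σ hσ := by
    obtain ⟨s, hs, hσs⟩ := Φ.rational σ hσ
    exact ⟨s, fun v hv => h (hs v hv), hσs⟩
  stronglyConvex := Φ.stronglyConvex
  face_mem := Φ.face_mem
  inf_face := Φ.inf_face

theorem dualMonoid_le_dualMonoid (h : N ≤ N') (σ : PointedCone ℝ V) :
    dualMonoid p N' σ ≤ dualMonoid p N σ :=
  fun _ hm => ⟨dualLattice_anti p h hm.1, hm.2⟩

/-- The inclusion `ℂ[σ^∨ ∩ M'] → ℂ[σ^∨ ∩ M]` for `N ⊆ N'`. -/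
def latticeRingMap (h : N ≤ N') (σ : PointedCone ℝ V) : ConeRing p N' σ →ₐ[ℂ] ConeRing p N σ :=
  AddMonoidAlgebra.mapDomainAlgHom ℂ ℂ (AddSubmonoid.inclusion (dualMonoid_le_dualMonoid p h σ))

theorem latticeRingMap_single (h : N ≤ N') (σ : PointedCone ℝ V) (m : dualMonoid p N' σ) (c : ℂ) :
    latticeRingMap p h σ (AddMonoidAlgebra.single m c) =
      AddMonoidAlgebra.single (AddSubmonoid.inclusion (dualMonoid_le_dualMonoid p h σ) m) c := by
  simp [latticeRingMap]

theorem latticeRingMap_injective (h : N ≤ N') (σ : PointedCone ℝ V) :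
    Function.Injective (latticeRingMap p h σ) :=
  AddMonoidAlgebra.mapDomain_injective
    (AddSubmonoid.inclusion_injective (dualMonoid_le_dualMonoid p h σ))

theorem coneRingMap_comp_latticeRingMap (h : N ≤ N') {τ σ : PointedCone ℝ V} (hτσ : τ ≤ σ) :
    (coneRingMap p N hτσ).comp (latticeRingMap p h σ) =
      (latticeRingMap p h τ).comp (coneRingMap p N' hτσ) :=
  AddMonoidAlgebra.algHom_ext (fun m => by
    rw [AlgHom.comp_apply, AlgHom.comp_apply, latticeRingMap_single, coneRingMap_single,
      coneRingMap_single, latticeRingMap_single]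
    rfl) (Subsingleton.elim _ _)

/-! ### Invariants of the torus action on cone rings -/

variable [p.IsPerfPair]

/-- The torus acts diagonally on monomials, so invariance can be read off one coefficient at a time.
-/
theorem coeff_coneRingTwist (t : Torus p N) (σ : PointedCone ℝ V) (a : ConeRing p N σ)
    (m : dualMonoid p N σ) :
    (coneRingTwist p t σ a).coeff m =
      a.coeff m * (t (Multiplicative.ofAdd ⟨(m : W), m.2.1⟩) : ℂˣ) := by
  classical
  induction a using AddMonoidAlgebra.induction_linear with
  | zero => simp
  | add a b ha hb => simp [ha, hb, add_mul]
  | single u c =>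
    rw [coneRingTwist_single, AddMonoidAlgebra.coeff_single, AddMonoidAlgebra.coeff_single,
      Finsupp.single_apply, Finsupp.single_apply]
    split_ifs with h
    · rw [h]
    · rw [zero_mul]

theorem torusExp_eq_one_iff (v : V) (m : dualLattice p N) :
    torusExp p v (Multiplicative.ofAdd m) = (1 : ℂˣ) ↔ ∃ k : ℤ, p v m = k := by
  rw [← Units.val_inj]
  change Complex.exp (2 * Real.pi * Complex.I * (p v m : ℝ)) = 1 ↔ _
  rw [Complex.exp_eq_one_iff]
  refine exists_congr fun k => ?_
  rw [mul_comm (k : ℂ), mul_right_inj' Complex.two_pi_I_ne_zero]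
  exact_mod_cast Iff.rfl

theorem quotientToTorus_mk (v : N') :
    quotientToTorus p N' (Multiplicative.ofAdd (Submodule.Quotient.mk v)) =
      (torusExp p (v : V) : Torus p N) := rfl

/-- The functions invariant under `N' / N` are those with exponents in `M'`. -/
theorem mem_range_latticeRingMap (h : N ≤ N') (σ : PointedCone ℝ V) {a : ConeRing p N σ}
    (ha : ∀ g, coneRingTwist p (quotientToTorus p N' g) σ a = a) :
    a ∈ (latticeRingMap p h σ).range := by
  rw [← AddMonoidAlgebra.sum_coeff_single a]
  refine sum_mem fun m hm => ?_
  have hm0 : a.coeff m ≠ 0 := Finsupp.mem_support_iff.1 hm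
  have hm' : (m : W) ∈ dualMonoid p N' σ := by
    refine ⟨fun v hv => ?_, m.2.2⟩
    -- Comparing coefficients at `m`, the nonzero coefficient cancels and leaves `exp(2πi⟨v, m⟩) =
    -- 1`, so `⟨v, m⟩` is an integer.
    have h1 := coeff_coneRingTwist p
      (quotientToTorus p N' (Multiplicative.ofAdd (Submodule.Quotient.mk ⟨v, hv⟩))) σ a m
    rw [ha, quotientToTorus_mk] at h1
    have h2 := mul_left_cancel₀ hm0 (h1.symm.trans (mul_one _).symm)
    exact (torusExp_eq_one_iff p v ⟨(m : W), m.2.1⟩).1 (Units.ext h2)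
  exact ⟨AddMonoidAlgebra.single ⟨m, hm'⟩ (a.coeff m), latticeRingMap_single p h σ _ _⟩

/-- Exponents from the smaller dual lattice pair integrally with `N'`, so each such monomial is
multiplied by `1`. -/
theorem coneRingTwist_latticeRingMap (h : N ≤ N') (σ : PointedCone ℝ V)
    (g : Multiplicative (N' ⧸ N.submoduleOf N')) :
    (coneRingTwist p (quotientToTorus p N' g) σ).comp (latticeRingMap p h σ) =
      latticeRingMap p h σ := by
  refine AddMonoidAlgebra.algHom_ext (fun m => ?_) (Subsingleton.elim _ _)
  rw [AlgHom.comp_apply, latticeRingMap_single, coneRingTwist_single]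
  congr 1
  obtain ⟨v, hv⟩ := Submodule.Quotient.mk_surjective _ g.toAdd
  have hg : g = Multiplicative.ofAdd (Submodule.Quotient.mk v) := by rw [hv]; rfl
  rw [hg, quotientToTorus_mk, (torusExp_eq_one_iff p _ _).2 (m.2.1 v v.2)]
  simp

/-- The action of a group on a cone ring through the torus. -/
abbrev coneRingAction {G : Type} [Group G] (t : G →* Torus p N) (σ : PointedCone ℝ V) :
    MulSemiringAction G (ConeRing p N σ) where
  smul g a := coneRingTwist p (t g) σ a
  one_smul a := by
    change coneRingTwist p (t 1) σ a = a
    rw [map_one, coneRingTwist_one]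
    rfl
  mul_smul g g' a := by
    change coneRingTwist p (t (g * g')) σ a = _
    rw [map_mul, coneRingTwist_mul]
    rfl
  smul_zero g := map_zero (coneRingTwist p (t g) σ)
  smul_add g := map_add (coneRingTwist p (t g) σ)
  smul_one g := map_one (coneRingTwist p (t g) σ)
  smul_mul g := map_mul (coneRingTwist p (t g) σ)

/-- The exponents embed in a rational vector space. Unique sums exclude zero divisors in the cone
ring, which is how the charts are seen to be reduced. -/
instance (σ : PointedCone ℝ V) : UniqueSums (dualMonoid p N σ) := by
  have : Module ℚ W := Module.compHom W (algebraMap ℚ ℝ)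
  exact UniqueSums.of_injective_addHom (dualMonoid p N σ).subtype.toAddHom
    Subtype.val_injective inferInstance

instance (Φ : Fan N) : AlgebraicGeometry.IsReduced (Φ.scheme p) := by
  have : ∀ i, AlgebraicGeometry.IsReduced
      ((Scheme.IsLocallyDirected.openCover (Φ.diagram p)).X i) := fun i =>
    inferInstanceAs (AlgebraicGeometry.IsReduced (Spec (CommRingCat.of (ConeRing p N i.1))))
  exact AlgebraicGeometry.IsReduced.of_openCover _ (Scheme.IsLocallyDirected.openCover (Φ.diagram p))

instance (Φ : Fan N) : AlgebraicGeometry.IsReduced (Φ.toricVariety p).left :=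
  inferInstanceAs (AlgebraicGeometry.IsReduced (Φ.scheme p))

/-! ### The toric morphism of an inclusion of lattices -/

/-- The maps `Spec ℂ[σ^∨ ∩ M] → Spec ℂ[σ^∨ ∩ M']` of affine charts. -/
def Fan.diagramMap (Φ : Fan N) (hN' : IsLattice N') (h : N ≤ N') :
    Φ.diagram p ⟶ (Φ.inLattice hN' h).diagram p where
  app σ := Spec.map (CommRingCat.ofHom (latticeRingMap p h σ.1).toRingHom)
  naturality {τ σ} f := by
    change Spec.map _ ≫ Spec.map _ = Spec.map _ ≫ Spec.map _
    rw [← Spec.map_comp, ← Spec.map_comp, ← CommRingCat.ofHom_comp, ← CommRingCat.ofHom_comp]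
    congr 2
    exact congrArg AlgHom.toRingHom (coneRingMap_comp_latticeRingMap p h (leOfHom f))

/-- The toric morphism given by an inclusion of lattices. -/
def Fan.latticeMap (Φ : Fan N) (hN' : IsLattice N') (h : N ≤ N') :
    Φ.toricVariety p ⟶ (Φ.inLattice hN' h).toricVariety p :=
  Over.homMk (colimMap (Φ.diagramMap p hN' h)) (by
    refine colimit.hom_ext fun σ => ?_
    change colimit.ι _ σ ≫ colimMap _ ≫ (Φ.inLattice hN' h).structureMap p = colimit.ι _ σ ≫ Φ.structureMap p
    rw [ι_colimMap_assoc, Fan.structureMap, colimit.ι_desc, Fan.structureMap, colimit.ι_desc]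
    change Spec.map _ ≫ Spec.map _ = Spec.map _
    rw [← Spec.map_comp, ← CommRingCat.ofHom_comp]
    congr 2
    exact (latticeRingMap p h σ.1).comp_algebraMap)

theorem Fan.ι_latticeMap (Φ : Fan N) (hN' : IsLattice N') (h : N ≤ N') (σ : Φ.cones) :
    colimit.ι (Φ.diagram p) σ ≫ (Φ.latticeMap p hN' h).left =
      (Φ.diagramMap p hN' h).app σ ≫ colimit.ι ((Φ.inLattice hN' h).diagram p) σ :=
  ι_colimMap _ _

theorem Fan.ι_latticeAction (Φ : Fan N) (N' : Submodule ℤ V) (σ : Φ.cones)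
    (g : Multiplicative (N' ⧸ N.submoduleOf N')) :
    colimit.ι (Φ.diagram p) σ ≫ (Φ.latticeAction p N' g).hom.left =
      (Φ.twist p (quotientToTorus p N' g)).app σ ≫ colimit.ι (Φ.diagram p) σ :=
  ι_colimMap _ _

theorem Fan.latticeAction_latticeMap (Φ : Fan N) (hN' : IsLattice N') (h : N ≤ N')
    (g : Multiplicative (N' ⧸ N.submoduleOf N')) :
    (Φ.latticeAction p N' g).hom ≫ Φ.latticeMap p hN' h = Φ.latticeMap p hN' h := by
  ext1
  refine colimit.hom_ext fun σ => ?_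
  rw [Over.comp_left]
  refine (Category.assoc _ _ _).symm.trans ?_
  refine (congrArg (· ≫ (Φ.latticeMap p hN' h).left) (Φ.ι_latticeAction p N' σ g)).trans ?_
  refine (Category.assoc _ _ _).trans
    ((congrArg (_ ≫ ·) (Φ.ι_latticeMap p hN' h σ)).trans ?_)
  rw [Fan.ι_latticeMap]
  refine (Category.assoc _ _ _).symm.trans
    (congrArg (· ≫ colimit.ι ((Φ.inLattice hN' h).diagram p) σ) ?_)
  change Spec.map _ ≫ Spec.map _ = Spec.map _
  rw [← Spec.map_comp, ← CommRingCat.ofHom_comp]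
  congr 2
  exact congrArg AlgHom.toRingHom (coneRingTwist_latticeRingMap p h σ.1 g)

/-- The preimage of a chart under the toric morphism of an inclusion of lattices is the
corresponding chart. -/
theorem Fan.mem_range_ι_of_latticeMap_mem (Φ : Fan N) (hN' : IsLattice N') (h : N ≤ N')
    (σ : Φ.cones) (x : Φ.scheme p)
    (hx : (Φ.latticeMap p hN' h).left x ∈
      Set.range (colimit.ι ((Φ.inLattice hN' h).diagram p) σ)) :
    x ∈ Set.range (colimit.ι (Φ.diagram p) σ) := by
  obtain ⟨τ, a, rfl⟩ := Scheme.IsLocallyDirected.ι_jointly_surjective (Φ.diagram p) x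
  obtain ⟨b, hb⟩ := hx
  have h1 : (Φ.latticeMap p hN' h).left (colimit.ι (Φ.diagram p) τ a) =
      colimit.ι ((Φ.inLattice hN' h).diagram p) τ ((Φ.diagramMap p hN' h).app τ a) :=
    congrArg (fun f : (Φ.diagram p).obj τ ⟶ (Φ.inLattice hN' h).scheme p => f a)
      (Φ.ι_latticeMap p hN' h τ)
  -- The image point lies in the charts of both `τ` and `σ`, hence in that of a cone `ρ` contained
  -- in both.
  obtain ⟨ρ, fσ, fτ, c, -, hcτ⟩ :=
    (Scheme.IsLocallyDirected.ι_eq_ι_iff ((Φ.inLattice hN' h).diagram p)).1 (hb.trans h1)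
  obtain ⟨m, hm⟩ := (Φ.inLattice hN' h).exists_monomial p τ.2
    ((Φ.inLattice hN' h).isConeFace_of_le τ.2 ρ.2 (leOfHom fτ))
  have h2 := ((Φ.inLattice hN' h).mem_range_diagram_map p fτ m hm _).1 ⟨c, hcτ⟩
  let fτ' : (⟨ρ.1, ρ.2⟩ : Φ.cones) ⟶ τ := homOfLE (leOfHom fτ)
  let fσ' : (⟨ρ.1, ρ.2⟩ : Φ.cones) ⟶ σ := homOfLE (leOfHom fσ)
  -- The chart of `ρ` inside that of `τ` is the locus where `χ^m` does not vanish, and the same `m`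
  -- cuts it out for either lattice. So the point upstairs also lies in the chart of `ρ`, and thus
  -- in that of `σ`.
  obtain ⟨d, hd⟩ := (Φ.mem_range_diagram_map p fτ'
    (AddSubmonoid.inclusion (dualMonoid_le_dualMonoid p h τ.1) m) hm a).2 (fun hmem => h2 (by
      change latticeRingMap p h τ.1 (AddMonoidAlgebra.single m 1) ∈
        PrimeSpectrum.asIdeal (R := ConeRing p N τ.1) a
      rw [latticeRingMap_single]
      exact hmem))
  refine ⟨(Φ.diagram p).map fσ' d, ?_⟩
  rw [← hd, ← Scheme.Hom.comp_apply, ← Scheme.Hom.comp_apply, colimit.w, colimit.w]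

/-- The toric morphism given by a finite index inclusion of lattices `N ⊆ N'` is the geometric
quotient by `N' / N`. -/
theorem Fan.isGeometricQuotient_latticeMap (Φ : Fan N) (hN' : IsLattice N') (h : N ≤ N') :
    IsGeometricQuotient (Φ.latticeAction p N') (Φ.latticeMap p hN' h) := by
  let G := Multiplicative (N' ⧸ N.submoduleOf N')
  have : Finite (N' ⧸ N.submoduleOf N') := Φ.isLattice.finite_quotient hN' h
  have : Finite G := inferInstanceAs (Finite (N' ⧸ N.submoduleOf N'))
  let _ : ∀ σ : Φ.cones, Algebra (ConeRing p N' σ.1) (ConeRing p N σ.1) :=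
    fun σ => (latticeRingMap p h σ.1).toRingHom.toAlgebra
  let _ : ∀ σ : Φ.cones, MulSemiringAction G (ConeRing p N σ.1) :=
    fun σ => coneRingAction p (quotientToTorus p N') σ.1
  have hsmul : ∀ (σ : Φ.cones) (b : ConeRing p N' σ.1) (a : ConeRing p N σ.1),
      b • a = latticeRingMap p h σ.1 b * a := fun _ _ _ => rfl
  have : ∀ σ : Φ.cones, SMulCommClass G (ConeRing p N' σ.1) (ConeRing p N σ.1) :=
    fun σ => ⟨fun g b a => by
      rw [hsmul, hsmul, smul_mul']
      congr 1
      exact DFunLike.congr_fun (coneRingTwist_latticeRingMap p h σ.1 g) b⟩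
  have : ∀ σ : Φ.cones, Algebra.IsInvariant (ConeRing p N' σ.1) (ConeRing p N σ.1) G :=
    fun σ => ⟨fun a ha => mem_range_latticeRingMap p h σ.1 ha⟩
  have : ∀ σ : Φ.cones, FaithfulSMul (ConeRing p N' σ.1) (ConeRing p N σ.1) :=
    fun σ => (faithfulSMul_iff_algebraMap_injective _ _).2 (latticeRingMap_injective p h σ.1)
  let f : ∀ σ : Φ.cones, Spec (CommRingCat.of (ConeRing p N σ.1)) ⟶ (Φ.toricVariety p).left :=
    fun σ => colimit.ι (Φ.diagram p) σ
  let f' : ∀ σ : Φ.cones, Spec (CommRingCat.of (ConeRing p N' σ.1)) ⟶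
      ((Φ.inLattice hN' h).toricVariety p).left :=
    fun σ => colimit.ι ((Φ.inLattice hN' h).diagram p) σ
  have : ∀ σ, IsOpenImmersion (f σ) := fun σ =>
    inferInstanceAs (IsOpenImmersion (colimit.ι (Φ.diagram p) σ))
  have : ∀ σ, IsOpenImmersion (f' σ) := fun σ =>
    inferInstanceAs (IsOpenImmersion (colimit.ι ((Φ.inLattice hN' h).diagram p) σ))
  refine IsGeometricQuotient.of_charts (G := G) (ι := Φ.cones) (Φ.latticeAction p N')
    (Φ.latticeMap p hN' h) (Φ.latticeAction_latticeMap p hN' h)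
    (fun σ => ConeRing p N σ.1) (fun σ => ConeRing p N' σ.1)
    f f' ?_ ?_ ?_ ?_
  · exact Φ.ι_latticeMap p hN' h
  · exact fun σ g => Φ.ι_latticeAction p N' σ g
  · exact Φ.mem_range_ι_of_latticeMap_mem p hN' h
  · exact Scheme.IsLocallyDirected.ι_jointly_surjective ((Φ.inLattice hN' h).diagram p)

end Refinement

/-! ### Mirror pairs -/

section MirrorQuotient

variable {V W : Type} [NormedAddCommGroup V] [NormedSpace ℝ V] [FiniteDimensional ℝ V]
  [NormedAddCommGroup W] [NormedSpace ℝ W] [FiniteDimensional ℝ W]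
  {p : V →ₗ[ℝ] W →ₗ[ℝ] ℝ} {N N₁ : Submodule ℤ V} {P : Set V}

theorem IsLatticePolytope.mono (hP : IsLatticePolytope N P) (hN₁ : IsLattice N₁) (h : N ≤ N₁) :
    IsLatticePolytope N₁ P := by
  obtain ⟨s, hs, hPs⟩ := hP.eq_convexHull
  exact ⟨hN₁, s, fun v hv => h (hs v hv), hPs⟩

/-- A reflexive polytope stays reflexive in every larger lattice whose dual contains the vertices
of the dual polytope. -/
theorem IsReflexive.inLattice [p.IsPerfPair] (hP : IsReflexive p N P) (hN₁ : IsLattice N₁)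
    (h : N ≤ N₁) (h' : primitiveLattice p P ≤ dualLattice p N₁) : IsReflexive p N₁ P :=
  ⟨hP.isLatticePolytope.mono hN₁ h, hP.zero_mem_interior,
    (hP.dual_isLatticePolytope.vertexLattice
      (zero_mem_interior_polarDual p hP.isLatticePolytope)).mono (hN₁.dualLattice p) h'⟩

end MirrorQuotient

end ToricMirror

end

theorem mainTheorem7 {V W : Type}
    [NormedAddCommGroup V] [NormedSpace ℝ V] [FiniteDimensional ℝ V]
    [NormedAddCommGroup W] [NormedSpace ℝ W] [FiniteDimensional ℝ W]
    (p : V →ₗ[ℝ] W →ₗ[ℝ] ℝ) [p.IsPerfPair] (N : Submodule ℤ V) (P : Set V)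
    (hP : ToricMirror.IsReflexive p N P) (M₁ : Submodule ℤ W)
    (h₁ : ToricMirror.primitiveLattice p P ≤ M₁) (h₂ : M₁ ≤ ToricMirror.dualLattice p N) :
    ∃ (X Y : Over (Spec (CommRingCat.of ℂ)))
      (π : hP.fan.toricVariety p ⟶ X) (ρ : hP.primitiveDualFan.toricVariety p.flip ⟶ Y),
      ToricMirror.IsGeometricQuotient
        (hP.fan.latticeAction p (ToricMirror.dualLattice p.flip M₁)) π ∧
      ToricMirror.IsGeometricQuotient (hP.primitiveDualFan.latticeAction p.flip M₁) ρ ∧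
      ToricMirror.IsBatyrevBorisovMirrorPair X Y := by
  have hM : ToricMirror.IsLattice (ToricMirror.dualLattice p N) :=
    hP.isLatticePolytope.isLattice.dualLattice p
  have hM₁ : ToricMirror.IsLattice M₁ :=
    hP.primitiveDualFan.isLattice.of_le_of_le hM h₁ h₂
  -- Replacing `M₁` by a literal dual lattice makes the fan of `P^∨` in `M₁` match the dual fan of
  -- `P` in `N₁` definitionally.
  obtain ⟨N₁, hN₁, rfl⟩ : ∃ N₁, ToricMirror.IsLattice N₁ ∧ M₁ = ToricMirror.dualLattice p N₁ :=
    ⟨_, hM₁.dualLattice p.flip, (hM₁.dualLattice_dualLattice p.flip).symm⟩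
  have hle : N ≤ N₁ := by
    rw [← hP.isLatticePolytope.isLattice.dualLattice_dualLattice p,
      ← hN₁.dualLattice_dualLattice p]
    exact ToricMirror.dualLattice_anti p.flip h₂
  rw [hN₁.dualLattice_dualLattice p]
  -- The witness for the mirror pair is `P` in `N₁`. Its fan and dual fan have the same cones and
  -- lattices as the two enlarged fans, so identity isomorphisms suffice.
  exact ⟨_, _, hP.fan.latticeMap p hN₁ hle, hP.primitiveDualFan.latticeMap p.flip hM₁ h₁,
    hP.fan.isGeometricQuotient_latticeMap p hN₁ hle,
    hP.primitiveDualFan.isGeometricQuotient_latticeMap p.flip hM₁ h₁,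
    V, W, inferInstance, inferInstance, inferInstance, inferInstance, inferInstance, inferInstance,
    p, inferInstance, N₁, P, hP.inLattice hN₁ hle h₁, ⟨Iso.refl _⟩, ⟨Iso.refl _⟩⟩
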